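/- Let $V$ be a Euclidean space with inner product $(\cdot,\cdot)$ and let $\Phi\subset V$ be an irreducible (finite, reduced, crystallographic, spanning) root system with Weyl group $W$, a set of simple roots $\Delta=\{\alpha_1,\dots,\alpha_\ell\}$, positive roots $\Phi^+$ and highest root $\widetilde\alpha=\sum_{i=1}^\ell c_i\alpha_i$; put $\alpha_0=-\widetilde\alpha$ and $c_0=1$. Let $\check Q=\sum_{\alpha\in\Phi}\mathbb Z\,\frac{2\alpha}{(\alpha,\alpha)}$ be the coroot lattice, $\check P=\{x\in V:(\alpha_i,x)\in\mathbb Z,\ 1\le i\le\ell\}$ the coweight lattice, and $f=\#(\check P/\check Q)$ the index of connection. For $w\in W$ put $$\operatorname{asc}(w)=\sum_{0\le i\le \ell,\ w(\alpha_i)\in\Phi^+}c_i .$$ An alcove is a connected component of $V\setminus\bigcup_{\alpha\in\Phi^+,\,k\in\mathbb Z}\{x\in V:(\alpha,x)=k\}$. The fundamental alcove is $A^\circ=\{x\in V:(\alpha_i,x)>0\ (1\le i\le\ell),\ (\widetilde\alpha,x)<1\}$, and the fundamental parallelepiped is $P^\diamondsuit=\{x\in V: 0<(\alpha_i,x)\le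 1,\ 1\le i\le\ell\}$. Then every alcove $A'$ can be written as $A'=w(A^\circ)+\gamma$ with $w\in W$ and $\gamma\in\check Q$, and $\operatorname{asc}(A'):=\operatorname{asc}(w)$ is well defined; indeed $\operatorname{asc}(A')=\operatorname{asc}(w)$ whenever $A'=w(A^\circ)+\gamma$ with $w\in W$ and $\gamma\in V$. There are finitely many alcoves contained in $P^\diamondsuit$, and $$\frac1f\sum_{w\in W}t^{\operatorname{asc}(w)}=\sum_{A'\subset P^\diamondsuit}t^{\operatorname{asc}(A')}\qquad\text{in }\mathbb Q[t],$$ where the sum on the right is over all alcoves $A'$ contained in $P^\diamondsuit$. -/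

import Mathlib

open Set Polynomial
open scoped RealInnerProductSpace

noncomputable section

namespace AffineWeyl

variable {ι V : Type*} [NormedAddCommGroup V] [InnerProductSpace ℝ V]

/-- A root pairing of a Euclidean space `V` with itself is *Euclidean* if the duality is the inner
product and the coroot of each root `α` is `2α/(α, α)`. Together with
`RootPairing.IsRootSystem` and `Finite ι` this says that the range of `P.root` is a root system in
the Euclidean space `V` in the classical sense (the reflections are the orthogonal ones). -/
structure IsEuclidean (P : RootPairing ι ℝ V V) : Prop where
  toLinearMap_apply : ∀ x y : V, P.toLinearMap x y = ⟪x, y⟫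
  coroot_eq : ∀ i, P.coroot i = (2 / ⟪P.root i, P.root i⟫) • P.root i

/-- The affine hyperplane `H_{α, k}`, where `α` is the root with index `i`. -/
def hyperplane (P : RootPairing ι ℝ V V) (i : ι) (k : ℤ) : Set V :=
  {x | ⟪P.root i, x⟫ = (k : ℝ)}

variable {P : RootPairing ι ℝ V V}

/-- The complement of all the hyperplanes `H_{α, k}` with `α` a positive root and `k` an integer. -/
def hyperplaneComplement (b : P.Base) : Set V :=
  {x | ∀ i, b.IsPos i → ∀ k : ℤ, x ∉ hyperplane P i k}

/-- An alcove is a connected component of the complement of the affine Weyl arrangement. -/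
def IsAlcove (b : P.Base) (A : Set V) : Prop :=
  ∃ x ∈ hyperplaneComplement b, A = connectedComponentIn (hyperplaneComplement b) x

/-- The coroot lattice, generated by the coroots. -/
def corootLattice (P : RootPairing ι ℝ V V) : AddSubgroup V :=
  AddSubgroup.closure (range P.coroot)

/-- The coweight lattice: the vectors whose products with all simple roots are integers. -/
def coweightLattice (b : P.Base) : AddSubgroup V where
  carrier := {x | ∀ i ∈ b.support, ∃ n : ℤ, ⟪P.root i, x⟫ = (n : ℝ)}
  zero_mem' := fun i _ => ⟨0, by simp⟩
  add_mem' := by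
    intro x y hx hy i hi
    obtain ⟨m, hm⟩ := hx i hi
    obtain ⟨n, hn⟩ := hy i hi
    exact ⟨m + n, by rw [inner_add_right, hm, hn]; push_cast; ring⟩
  neg_mem' := by
    intro x hx i hi
    obtain ⟨m, hm⟩ := hx i hi
    exact ⟨-m, by rw [inner_neg_right, hm]; push_cast; ring⟩

/-- The index of connection `f`: the index of the coroot lattice in the coweight lattice. -/
def indexOfConnection (b : P.Base) : ℕ :=
  (corootLattice P).relIndex (coweightLattice b)

/-- The fundamental parallelepiped `P = {x | 0 < (αᵢ, x) ≤ 1 for all simple roots αᵢ}`. -/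
def parallelepiped (b : P.Base) : Set V :=
  {x | ∀ i ∈ b.support, 0 < ⟪P.root i, x⟫ ∧ ⟪P.root i, x⟫ ≤ 1}

/-- The set of positive roots (as vectors). -/
def positiveRoots (b : P.Base) : Set V :=
  {x | ∃ i, b.IsPos i ∧ P.root i = x}

/-- The root with index `θ` is the highest root: `θ - β` is a sum of simple roots for every
root `β`. -/
def IsHighestRoot (b : P.Base) (θ : ι) : Prop :=
  ∀ j, P.root θ - P.root j ∈ AddSubmonoid.closure (P.root '' (b.support : Set ι))

lemma exists_nat_of_mem_closure (b : P.Base) {x : V}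
    (hx : x ∈ AddSubmonoid.closure (P.root '' (b.support : Set ι))) :
    ∃ f : b.support → ℕ, x = ∑ i, f i • P.root i := by
  classical
  induction hx using AddSubmonoid.closure_induction with
  | mem x hx =>
    obtain ⟨j, hj, rfl⟩ := hx
    exact ⟨Pi.single ⟨j, hj⟩ 1, by simp [Pi.single_apply, ite_smul]⟩
  | zero => exact ⟨0, by simp⟩
  | add x y _ _ hx hy =>
    obtain ⟨f, rfl⟩ := hx
    obtain ⟨g, rfl⟩ := hy
    exact ⟨f + g, by simp [add_smul, Finset.sum_add_distrib]⟩

section HighestRoot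

lemma pairingIn_eq_sum [P.IsCrystallographic] (b : P.Base) {θ : ι} {f : b.support → ℤ}
    (hf : P.root θ = ∑ i, f i • P.root i) (j : ι) :
    P.pairingIn ℤ θ j = ∑ i, f i * P.pairingIn ℤ i j := by
  apply FaithfulSMul.algebraMap_injective ℤ ℝ
  simp only [RootPairing.algebraMap_pairingIn, map_sum, ← RootPairing.root_coroot_eq_pairing, hf,
    map_zsmul, LinearMap.coe_sum, Finset.sum_apply, LinearMap.smul_apply, map_mul]
  simp

/-- Every root lies below a root that is maximal in the root order. -/
lemma exists_maximal_above [Finite ι] (b : P.Base) (j : ι) :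
    ∃ θ, P.root θ - P.root j ∈ AddSubmonoid.closure (P.root '' (b.support : Set ι)) ∧
      ∀ k, P.root k - P.root θ ∈ AddSubmonoid.closure (P.root '' (b.support : Set ι)) → k = θ := by
  obtain ⟨θ, hθ, hmax⟩ := Set.exists_max_image
    {k | P.root k - P.root j ∈ AddSubmonoid.closure (P.root '' (b.support : Set ι))} b.height
    (Set.toFinite _) ⟨j, by simp⟩
  refine ⟨θ, hθ, fun k hk => ?_⟩
  have h1 := hmax k (by simpa using add_mem hk hθ)
  obtain ⟨f, hf⟩ := exists_nat_of_mem_closure b hk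
  obtain ⟨g, -, -, hg⟩ := b.exists_root_eq_sum_int θ
  classical
  let F : ι → ℤ := fun i => if h : i ∈ b.support then f ⟨i, h⟩ else 0
  have hF : ∑ i ∈ b.support, F i • P.root i = ∑ i, f i • P.root i := by
    rw [← Finset.sum_coe_sort]
    exact Finset.sum_congr rfl fun i _ => by simp [F]
  have hk' : P.root k = ∑ i ∈ b.support, (F + g) i • P.root i := by
    simp only [Pi.add_apply, add_smul, Finset.sum_add_distrib]
    rw [← hg, hF, ← hf]; abel
  rw [RootPairing.Base.height_eq_sum hk', RootPairing.Base.height_eq_sum hg] at h1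
  simp only [Pi.add_apply, Finset.sum_add_distrib] at h1
  have hF0 : ∀ i ∈ b.support, 0 ≤ F i := fun i hi => by simp [F, hi]
  have h2 : ∑ i ∈ b.support, F i = 0 := le_antisymm (by linarith) (Finset.sum_nonneg hF0)
  rw [Finset.sum_eq_zero_iff_of_nonneg hF0] at h2
  have h3 : P.root k - P.root θ = 0 := by
    rw [hf, ← hF]
    exact Finset.sum_eq_zero fun i hi => by rw [h2 i hi, zero_smul]
  exact P.root.injective (sub_eq_zero.mp h3)

lemma pairingIn_nonneg_of_maximal [Finite ι] [P.IsCrystallographic] (b : P.Base) {θ : ι}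
    (hθ : ∀ k, P.root k - P.root θ ∈ AddSubmonoid.closure (P.root '' (b.support : Set ι)) → k = θ)
    {j : ι} (hj : j ∈ b.support) : 0 ≤ P.pairingIn ℤ θ j := by
  by_contra! h
  have hmem : P.root j ∈ AddSubmonoid.closure (P.root '' (b.support : Set ι)) :=
    AddSubmonoid.subset_closure ⟨j, hj, rfl⟩
  have : IsAddTorsionFree V := .of_isTorsionFree ℝ V
  by_cases hn : P.root θ = -P.root j
  · have := hθ j (by rw [hn, sub_neg_eq_add]; exact add_mem hmem hmem)
    rw [this, self_eq_neg] at hn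
    exact P.ne_zero _ hn
  · obtain ⟨k, hk⟩ := P.root_add_root_mem_of_pairingIn_neg h hn
    have := hθ k (by rw [hk, add_sub_cancel_left]; exact hmem)
    rw [this, left_eq_add] at hk
    exact P.ne_zero _ hk

variable [Finite ι] [P.IsCrystallographic] [P.IsReduced] [P.IsIrreducible]

lemma exists_pos_of_maximal (b : P.Base) {θ : ι}
    (hθ : ∀ k, P.root k - P.root θ ∈ AddSubmonoid.closure (P.root '' (b.support : Set ι)) → k = θ) :
    ∃ f : b.support → ℕ, P.root θ = ∑ i, f i • P.root i ∧ ∀ i, 0 < f i := by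
  have : IsAddTorsionFree V := .of_isTorsionFree ℝ V
  have hmem : P.root θ ∈ AddSubmonoid.closure (P.root '' (b.support : Set ι)) := by
    refine (b.root_mem_or_neg_mem θ).resolve_right fun h => ?_
    have h1 := hθ (P.reflectionPerm θ θ) (by
      rw [P.root_reflectionPerm, P.reflection_apply_self, sub_eq_add_neg]; exact add_mem h h)
    have h2 : P.root (P.reflectionPerm θ θ) = P.root θ := by rw [h1]
    rw [P.root_reflectionPerm, P.reflection_apply_self, neg_eq_self] at h2
    exact P.ne_zero _ h2
  obtain ⟨f, hf⟩ := exists_nat_of_mem_closure b hmem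
  refine ⟨f, hf, ?_⟩
  obtain ⟨i₀, hi₀⟩ : ∃ i, 0 < f i := by
    by_contra! h
    apply P.ne_zero θ
    rw [hf]
    exact Finset.sum_eq_zero fun i _ => by rw [Nat.le_zero.mp (h i), zero_smul]
  intro l
  refine RootPairing.Base.induction_on_cartanMatrix b (fun i => 0 < f i) hi₀ fun i j hi hij => ?_
  by_contra! hj
  have hj0 : f j = 0 := Nat.le_zero.mp hj
  apply hij
  have h1 := pairingIn_nonneg_of_maximal b hθ j.2
  rw [pairingIn_eq_sum b (f := fun i => (f i : ℤ)) (by simpa using hf)] at h1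
  have hle : ∀ k ∈ Finset.univ, (f k : ℤ) * P.pairingIn ℤ k j ≤ 0 := by
    intro k _
    by_cases hk : k = j
    · simp [hk, hj0]
    · exact mul_nonpos_of_nonneg_of_nonpos (by positivity)
        (b.pairingIn_le_zero_of_ne (fun h => hk (Subtype.ext h)) k.2 j.2)
  have h2 := (Finset.sum_eq_zero_iff_of_nonpos hle).mp (le_antisymm (Finset.sum_nonpos hle) h1) i
    (Finset.mem_univ i)
  have h3 : P.pairingIn ℤ i j = 0 := by
    rcases mul_eq_zero.mp h2 with h | h
    · have : f i = 0 := by exact_mod_cast h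
      omega
    · exact h
  exact P.pairingIn_eq_zero_iff.mp h3

variable [P.IsRootSystem]

lemma exists_isHighestRoot (b : P.Base) : ∃ θ, IsHighestRoot b θ := by
  have hV : Nontrivial V := RootPairing.IsIrreducible.nontrivial P
  have hι : Nonempty ι := by
    by_contra h
    rw [not_nonempty_iff] at h
    have := RootPairing.IsRootSystem.span_root_eq_top (P := P)
    rw [range_eq_empty, Submodule.span_empty] at this
    exact bot_ne_top this
  obtain ⟨θ, -, hθ⟩ := exists_maximal_above b hι.some
  refine ⟨θ, fun j => ?_⟩
  obtain ⟨η, hηj, hη⟩ := exists_maximal_above b j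
  suffices η = θ from this ▸ hηj
  by_contra hne
  obtain ⟨f, hf, hfpos⟩ := exists_pos_of_maximal b hη
  have hnn : ∀ i : b.support, 0 ≤ P.pairingIn ℤ i θ := fun i => by
    have := pairingIn_nonneg_of_maximal b hθ i.2
    contrapose! this
    exact (P.pairingIn_lt_zero_iff ℤ).mp this
  obtain ⟨i, hi, hi0⟩ := b.exists_mem_support_pos_pairingIn_ne_zero θ
  have hpos : 0 < P.pairingIn ℤ η θ := by
    rw [pairingIn_eq_sum b (f := fun i => (f i : ℤ)) (by simpa using hf)]
    refine Finset.sum_pos' (fun k _ => mul_nonneg (by positivity) (hnn k))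
      ⟨⟨i, hi⟩, Finset.mem_univ _, ?_⟩
    exact mul_pos (by exact_mod_cast hfpos _) (lt_of_le_of_ne (hnn ⟨i, hi⟩) (Ne.symm hi0))
  obtain ⟨k, hk⟩ := P.root_sub_root_mem_of_pairingIn_pos hpos hne
  rcases b.root_mem_or_neg_mem k with h | h
  · exact hne (hθ η (hk ▸ h))
  · rw [hk, neg_sub] at h
    exact hne (hη θ h).symm

/-- The (index of the) highest root. -/
def highestRoot (b : P.Base) : ι :=
  (exists_isHighestRoot b).choose

lemma isHighestRoot_highestRoot (b : P.Base) : IsHighestRoot b (highestRoot b) :=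
  (exists_isHighestRoot b).choose_spec

lemma exists_marks (b : P.Base) :
    ∃ c : b.support → ℕ, P.root (highestRoot b) = ∑ i, c i • P.root i := by
  obtain ⟨f, hf, -⟩ := exists_pos_of_maximal b (θ := highestRoot b) fun k hk => by
    obtain ⟨f, hf⟩ := exists_nat_of_mem_closure b hk
    obtain ⟨g, hg⟩ := exists_nat_of_mem_closure b (isHighestRoot_highestRoot b k)
    have hfg : ∑ i : b.support, ((f i : ℝ) + g i) • P.root i = 0 := by
      simp only [add_smul, Finset.sum_add_distrib, Nat.cast_smul_eq_nsmul]
      rw [← hf, ← hg]; abel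
    have hli := Fintype.linearIndependent_iff.mp b.linearIndepOn_root.linearIndependent _ hfg
    refine P.root.injective (sub_eq_zero.mp ?_)
    rw [hf]
    refine Finset.sum_eq_zero fun i _ => ?_
    have h0 : (f i : ℝ) + g i = 0 := hli i
    have : f i + g i = 0 := by exact_mod_cast h0
    rw [(by omega : f i = 0), zero_smul]
  exact ⟨f, hf⟩

/-- The coefficients `c₁, …, c_ℓ` of the highest root with respect to the simple roots. -/
def mark (b : P.Base) : b.support → ℕ :=
  (exists_marks b).choose

lemma highestRoot_eq_sum_mark (b : P.Base) :
    P.root (highestRoot b) = ∑ i, mark b i • P.root i :=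
  (exists_marks b).choose_spec

/-- The extended simple system `α₀, α₁, …, α_ℓ`: the index `none` stands for `0`, and `α₀` is
minus the highest root. -/
def extRoot (b : P.Base) : Option b.support → V
  | none => -P.root (highestRoot b)
  | some i => P.root i

/-- The coefficients `c₀ = 1, c₁, …, c_ℓ`. -/
def extMark (b : P.Base) : Option b.support → ℕ
  | none => 1
  | some i => mark b i

open scoped Classical in
/-- `asc w` is the sum of the `cᵢ`, `0 ≤ i ≤ ℓ`, over those `i` for which `w(αᵢ)` is positive. -/
def asc (b : P.Base) (w : P.weylGroup) : ℕ :=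
  ∑ i : Option b.support, if w • extRoot b i ∈ positiveRoots b then extMark b i else 0

/-- The fundamental alcove. -/
def fundamentalAlcove (b : P.Base) : Set V :=
  {x | (∀ i ∈ b.support, 0 < ⟪P.root i, x⟫) ∧ ⟪P.root (highestRoot b), x⟫ < 1}

/-- The translate `w(A°) + γ` of the image of the fundamental alcove `A°` under `w`. -/
def alcoveOf (b : P.Base) (w : P.weylGroup) (γ : V) : Set V :=
  (fun x : V => w • x + γ) '' fundamentalAlcove b

open scoped Classical in
/-- The extension of `asc` to alcoves: `asc A = asc w` if `A = w(A°) + γ` with `w` in the Weyl group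
and `γ` in the coroot lattice. (A pair `(w, γ)` is chosen; the value on sets that are not of this
form is irrelevant.) -/
def ascAlcove (b : P.Base) (A : Set V) : ℕ :=
  if h : ∃ p : P.weylGroup × V, p.2 ∈ corootLattice P ∧ A = alcoveOf b p.1 p.2 then
    asc b h.choose.1
  else 0

end HighestRoot

/-- The Weyl group of a finite root system is finite. -/
instance finite_weylGroup [Finite ι] [P.IsRootSystem] : Finite P.weylGroup := by
  refine Finite.of_injective (fun w : P.weylGroup => P.weylGroupToPerm w) fun w w' h => ?_
  have h1 : ∀ i, w • P.root i = w' • P.root i := fun i => by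
    rw [P.weylGroup_apply_root, P.weylGroup_apply_root]
    exact congrArg (fun e : Equiv.Perm ι => P.root (e i)) h
  apply Subtype.ext
  apply RootPairing.Equiv.weightHom_injective P
  apply LinearEquiv.toLinearMap_injective
  refine LinearMap.ext_on_range (v := P.root) RootPairing.IsRootSystem.span_root_eq_top fun i => ?_
  exact h1 i

section Eulerian

variable [Finite ι] [P.IsRootSystem] [P.IsCrystallographic] [P.IsReduced] [P.IsIrreducible]

/-- The generalized Eulerian polynomial `(1/f) ∑_{w ∈ W} t^{asc(w)}`. -/
def eulerianPolynomial (b : P.Base) : ℚ[X] :=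
  letI := Fintype.ofFinite P.weylGroup
  C (1 / (indexOfConnection b : ℚ)) * ∑ w : P.weylGroup, X ^ asc b w

end Eulerian

end AffineWeyl

end

/-! Translating by a coweight changes the simple coordinates `(αᵢ, x)` of a point by arbitrary
integers. Hence each `w(A°)` has exactly one coweight translate inside the fundamental
parallelepiped, and `w ↦ w(A°) + g(w)` maps the Weyl group to the alcoves there
(`exists_alcoveOf_subset_parallelepiped`, `translation_eq_of_alcoveOf_subset_parallelepiped`).

The fibre over `A'` consists of the `w` with `A' = w(A°) + γ` for some coweight `γ`, and `w ↦ [γ]`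
is a bijection from it to coweights modulo coroots (`card_alcoveOf_eq`). It is onto because the
affine Weyl group is transitive on alcoves (`exists_mem_alcoveOf`: move a point as close as possible
to `A°`), and injective because the action is free (`eq_one_of_alcoveOf_eq_fundamentalAlcove`). So
every fibre has `f` elements.

Finally `asc` is constant on fibres (`asc_eq_of_alcoveOf_eq`): an affine map preserving `A°`
permutes its walls, hence the roots `α₀, …, α_ℓ`, and it preserves the marks because these are the
coefficients in the relation `∑ cᵢ · (wall function i) = 1`. Summing over fibres and dividing by `f`
gives the identity. -/

namespace AffineWeyl

open RootPairing

/-! ### The Weyl group: isometries, generation by simple reflections, exchange condition. -/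

section WeylGroup

variable {ι V : Type*} [NormedAddCommGroup V] [InnerProductSpace ℝ V] {P : RootPairing ι ℝ V V}

lemma IsEuclidean.smul_ofIdx (hP : IsEuclidean P) (i : ι) (x : V) :
    weylGroup.ofIdx P i • x = x - ⟪P.root i, x⟫ • P.coroot i := by
  change P.reflection i x = _
  rw [P.reflection_apply]
  change x - P.toLinearMap x (P.coroot i) • P.root i = _
  rw [hP.toLinearMap_apply, hP.coroot_eq, inner_smul_right, smul_smul, real_inner_comm x,
    mul_comm (2 / _)]

lemma root_inner_self_pos (P : RootPairing ι ℝ V V) (i : ι) : 0 < ⟪P.root i, P.root i⟫ :=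
  real_inner_self_pos.mpr (P.ne_zero i)

lemma IsEuclidean.inner_root_coroot_self (hP : IsEuclidean P) (i : ι) :
    ⟪P.root i, P.coroot i⟫ = 2 := by
  rw [← hP.toLinearMap_apply, P.root_coroot_two]

lemma IsEuclidean.inner_smul_smul (hP : IsEuclidean P) (w : P.weylGroup) (x y : V) :
    ⟪w • x, w • y⟫ = ⟪x, y⟫ := by
  obtain ⟨w, hw⟩ := w
  induction hw using weylGroup.induction generalizing x y with
  | mem i =>
    change ⟪weylGroup.ofIdx P i • x, weylGroup.ofIdx P i • y⟫ = _
    rw [hP.smul_ofIdx, hP.smul_ofIdx]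
    have h := hP.inner_root_coroot_self i
    have h0 := (root_inner_self_pos P i).ne'
    simp only [hP.coroot_eq, inner_smul_right, inner_sub_left, inner_sub_right, inner_smul_left,
      conj_trivial, real_inner_comm (P.root i)] at h ⊢
    field_simp
    ring
  | one => rfl
  | mul u v hu hv ihu ihv =>
    exact (ihu _ _).trans (ihv x y)

lemma IsEuclidean.inner_smul_left_eq (hP : IsEuclidean P) (w : P.weylGroup) (x y : V) :
    ⟪w • x, y⟫ = ⟪x, w⁻¹ • y⟫ := by
  rw [← hP.inner_smul_smul w x (w⁻¹ • y), smul_inv_smul]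

lemma IsEuclidean.inner_root_smul (hP : IsEuclidean P) (w : P.weylGroup) (i : ι) (x : V) :
    ⟪P.root i, w • x⟫ = ⟪P.root (P.weylGroupToPerm w⁻¹ i), x⟫ := by
  rw [← P.weylGroup_apply_root, hP.inner_smul_left_eq, inv_inv]

lemma weylGroup_smul_smul (w : P.weylGroup) (r : ℝ) (x : V) : w • r • x = r • w • x :=
  smul_comm (w : P.Aut) r x

lemma IsEuclidean.smul_coroot (hP : IsEuclidean P) (w : P.weylGroup) (i : ι) :
    w • P.coroot i = P.coroot (P.weylGroupToPerm w i) := by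
  rw [hP.coroot_eq, hP.coroot_eq, weylGroup_smul_smul, ← P.weylGroup_apply_root,
    hP.inner_smul_smul]

lemma weylGroupToPerm_injective [P.IsRootSystem] :
    Function.Injective P.weylGroupToPerm := by
  intro w w' h
  apply Subtype.ext
  apply RootPairing.Equiv.weightHom_injective P
  apply LinearEquiv.toLinearMap_injective
  refine LinearMap.ext_on_range (v := P.root) RootPairing.IsRootSystem.span_root_eq_top fun i => ?_
  change w • P.root i = w' • P.root i
  rw [P.weylGroup_apply_root, P.weylGroup_apply_root, h]

lemma IsEuclidean.ofIdx_weylGroupToPerm [P.IsRootSystem] (hP : IsEuclidean P) (w : P.weylGroup)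
    (i : ι) :
    weylGroup.ofIdx P (P.weylGroupToPerm w i) = w * weylGroup.ofIdx P i * w⁻¹ := by
  apply weylGroupToPerm_injective
  ext j
  apply P.root.injective
  rw [← P.weylGroup_apply_root, ← P.weylGroup_apply_root, mul_smul, mul_smul, hP.smul_ofIdx,
    hP.smul_ofIdx, smul_sub, weylGroup_smul_smul, hP.smul_coroot, smul_inv_smul,
    ← P.weylGroup_apply_root, hP.inner_smul_left_eq]

lemma reflectionPerm_eq_weylGroupToPerm (i : ι) :
    P.reflectionPerm i = P.weylGroupToPerm (weylGroup.ofIdx P i) := rfl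

lemma root_reflectionPerm_self (i : ι) : P.root (P.reflectionPerm i i) = -P.root i := by
  rw [P.root_reflectionPerm, P.reflection_apply_self]

lemma weylGroupToPerm_reflectionPerm_self (w : P.weylGroup) (i : ι) :
    P.weylGroupToPerm w (P.reflectionPerm i i) =
      P.reflectionPerm (P.weylGroupToPerm w i) (P.weylGroupToPerm w i) := by
  apply P.root.injective
  rw [← P.weylGroup_apply_root, root_reflectionPerm_self, root_reflectionPerm_self, smul_neg,
    P.weylGroup_apply_root]

lemma isPos_reflectionPerm_self (b : P.Base) (i : ι) :
    b.IsPos (P.reflectionPerm i i) ↔ ¬ b.IsPos i :=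
  RootPairing.Base.IsPos.neg_iff_not b i

lemma ofIdx_mul_self [P.IsRootSystem] (i : ι) :
    weylGroup.ofIdx P i * weylGroup.ofIdx P i = 1 := by
  apply weylGroupToPerm_injective
  ext j
  rw [map_mul, Equiv.Perm.mul_apply, ← reflectionPerm_eq_weylGroupToPerm, P.reflectionPerm_self,
    map_one, Equiv.Perm.one_apply]

variable [Finite ι] [P.IsRootSystem] [P.IsCrystallographic] [P.IsReduced]

lemma IsEuclidean.ofIdx_mem_closure_simple (hP : IsEuclidean P) (b : P.Base) (i : ι) :
    weylGroup.ofIdx P i ∈ Subgroup.closure (weylGroup.ofIdx P '' b.support) := by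
  refine b.induction_reflect i (fun i hi => ?_)
    (fun i hi => Subgroup.subset_closure (mem_image_of_mem _ hi)) fun i j hi hj => ?_
  · rwa [reflectionPerm_eq_weylGroupToPerm, hP.ofIdx_weylGroupToPerm, mul_inv_cancel_right]
  · have hj' : weylGroup.ofIdx P j ∈ Subgroup.closure (weylGroup.ofIdx P '' b.support) :=
      Subgroup.subset_closure ⟨j, hj, rfl⟩
    rw [reflectionPerm_eq_weylGroupToPerm, hP.ofIdx_weylGroupToPerm]
    exact mul_mem (mul_mem hj' hi) (inv_mem hj')

lemma IsEuclidean.exists_list (hP : IsEuclidean P) (b : P.Base) (w : P.weylGroup) :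
    ∃ L : List ι, (∀ i ∈ L, i ∈ b.support) ∧ w = (L.map (weylGroup.ofIdx P)).prod := by
  have hw : w ∈ Subgroup.closure (weylGroup.ofIdx P '' b.support) := by
    obtain ⟨w, hw⟩ := w
    induction hw using weylGroup.induction with
    | mem i => exact hP.ofIdx_mem_closure_simple b i
    | one => exact one_mem _
    | mul u v hu hv ihu ihv => exact mul_mem ihu ihv
  induction hw using Subgroup.closure_induction'' with
  | one => exact ⟨[], by simp, by simp⟩
  | mem x hx =>
    obtain ⟨i, hi, rfl⟩ := hx
    exact ⟨[i], by simpa using hi, by simp⟩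
  | inv_mem x hx =>
    obtain ⟨i, hi, rfl⟩ := hx
    exact ⟨[i], by simpa using hi, by simpa using inv_eq_of_mul_eq_one_left (ofIdx_mul_self i)⟩
  | mul x y _ _ hx hy =>
    obtain ⟨L, hL, rfl⟩ := hx
    obtain ⟨M, hM, rfl⟩ := hy
    exact ⟨L ++ M, by simpa [or_imp, forall_and] using ⟨hL, hM⟩, by simp⟩

/-- The exchange condition: if a product of `n` simple reflections sends a simple root `αᵢ` to a
negative root, then multiplying it by `sᵢ` yields a product of `n - 1` simple reflections. -/
lemma IsEuclidean.exists_list_mul_ofIdx (hP : IsEuclidean P) (b : P.Base) {i : ι}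
    (hi : i ∈ b.support) (L : List ι) (hL : ∀ j ∈ L, j ∈ b.support)
    (hneg : ¬ b.IsPos (P.weylGroupToPerm (L.map (weylGroup.ofIdx P)).prod i)) :
    ∃ L' : List ι, (∀ j ∈ L', j ∈ b.support) ∧ L'.length + 1 = L.length ∧
      (L.map (weylGroup.ofIdx P)).prod * weylGroup.ofIdx P i =
        (L'.map (weylGroup.ofIdx P)).prod := by
  induction L with
  | nil => exact absurd (Base.isPos_of_mem_support hi) (by simpa using hneg)
  | cons a L ih =>
    have hL' : ∀ j ∈ L, j ∈ b.support := fun j hj => hL j (List.mem_cons_of_mem _ hj)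
    by_cases h : b.IsPos (P.weylGroupToPerm (L.map (weylGroup.ofIdx P)).prod i)
    -- A simple reflection makes no positive root negative except its own simple root, so the sign
    -- change at letter `a` forces the image of `αᵢ` to be `α_a`; then `s_a` is a conjugate of `sᵢ`
    -- and the two cancel.
    · have ha : P.weylGroupToPerm (L.map (weylGroup.ofIdx P)).prod i = a := by
        by_contra hne
        apply hneg
        rw [List.map_cons, List.prod_cons, map_mul, Equiv.Perm.mul_apply,
          ← reflectionPerm_eq_weylGroupToPerm]
        exact h.reflectionPerm (hL a (by simp)) hne
      refine ⟨L, hL', by simp, ?_⟩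
      have h2 := hP.ofIdx_weylGroupToPerm (L.map (weylGroup.ofIdx P)).prod i
      rw [ha] at h2
      rw [List.map_cons, List.prod_cons, h2, inv_mul_cancel_right, mul_assoc, ofIdx_mul_self,
        mul_one]
    · obtain ⟨L', h1, h2, h3⟩ := ih hL' h
      refine ⟨a :: L', ?_, by simpa using h2, ?_⟩
      · simpa using ⟨hL a (by simp), h1⟩
      · rw [List.map_cons, List.prod_cons, mul_assoc, h3, List.map_cons, List.prod_cons]

/-- An element of the Weyl group preserving the positive roots is trivial. -/
lemma IsEuclidean.eq_one_of_forall_isPos (hP : IsEuclidean P) (b : P.Base) (w : P.weylGroup)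
    (hw : ∀ i ∈ b.support, b.IsPos (P.weylGroupToPerm w i)) : w = 1 := by
  obtain ⟨L, hL, rfl⟩ := hP.exists_list b w
  induction hn : L.length using Nat.strong_induction_on generalizing L with
  | _ n ih =>
    rcases List.eq_nil_or_concat L with rfl | ⟨L, i, rfl⟩
    · simp
    · have hi : i ∈ b.support := hL i (by simp)
      -- For a word ending in `sᵢ`, positivity of `w αᵢ` means that the prefix makes `αᵢ` negative.
      -- The exchange condition then yields a word for `w` shorter by two.
      have h1 := hw i hi
      rw [List.concat_eq_append, List.map_append, List.prod_append, map_mul,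
        Equiv.Perm.mul_apply, List.map_singleton, List.prod_singleton,
        ← reflectionPerm_eq_weylGroupToPerm, weylGroupToPerm_reflectionPerm_self,
        isPos_reflectionPerm_self] at h1
      obtain ⟨L', h2, h3, h4⟩ := hP.exists_list_mul_ofIdx b hi L
        (fun j hj => hL j (by simp [hj])) h1
      have h5 : ((L.concat i).map (weylGroup.ofIdx P)).prod =
          (L'.map (weylGroup.ofIdx P)).prod := by simpa using h4
      rw [h5] at hw ⊢
      exact ih L'.length (by rw [List.length_concat] at hn; omega) L' h2 hw rfl

end WeylGroup

/-! ### Alcoves as cells cut out by the signs of all affine roots. -/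

section Alcoves

variable {ι V : Type*} [NormedAddCommGroup V] [InnerProductSpace ℝ V] {P : RootPairing ι ℝ V V}

lemma isPos_of_root_mem_closure (b : P.Base) {i : ι}
    (h : P.root i ∈ AddSubmonoid.closure (P.root '' (b.support : Set ι))) : b.IsPos i := by
  classical
  obtain ⟨f, hf⟩ := exists_nat_of_mem_closure b h
  let F : ι → ℤ := fun i => if h : i ∈ b.support then f ⟨i, h⟩ else 0
  have hF : ∑ i ∈ b.support, F i • P.root i = ∑ i, f i • P.root i := by
    rw [← Finset.sum_coe_sort]
    exact Finset.sum_congr rfl fun i _ => by simp [F]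
  rw [Base.isPos_iff', Base.height_eq_sum (hf.trans hF.symm)]
  exact Finset.sum_nonneg fun i hi => by simp [F, hi]

lemma isPos_iff_root_mem_closure (b : P.Base) (i : ι) :
    b.IsPos i ↔ P.root i ∈ AddSubmonoid.closure (P.root '' (b.support : Set ι)) := by
  refine ⟨fun h => (b.root_mem_or_neg_mem i).resolve_right fun h' => ?_,
    isPos_of_root_mem_closure b⟩
  rw [← root_reflectionPerm_self] at h'
  exact (isPos_reflectionPerm_self b i).mp (isPos_of_root_mem_closure b h') h

lemma eq_zero_or_inner_pos_of_mem_closure (b : P.Base) {v x : V}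
    (hx : ∀ i ∈ b.support, 0 < ⟪P.root i, x⟫)
    (hv : v ∈ AddSubmonoid.closure (P.root '' (b.support : Set ι))) : v = 0 ∨ 0 < ⟪v, x⟫ := by
  induction hv using AddSubmonoid.closure_induction with
  | mem v hv =>
    obtain ⟨j, hj, rfl⟩ := hv
    exact Or.inr (hx j hj)
  | zero => exact Or.inl rfl
  | add u v _ _ hu hv =>
    rcases hu with rfl | hu <;> rcases hv with rfl | hv
    · simp
    · right; simpa using hv
    · right; simpa using hu
    · right; rw [inner_add_left]; exact add_pos hu hv

lemma inner_root_pos_of_isPos (b : P.Base) {x : V} (hx : ∀ i ∈ b.support, 0 < ⟪P.root i, x⟫)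
    {i : ι} (hi : b.IsPos i) : 0 < ⟪P.root i, x⟫ :=
  (eq_zero_or_inner_pos_of_mem_closure b hx
    ((isPos_iff_root_mem_closure b i).mp hi)).resolve_left (P.ne_zero i)

/-- The hyperplanes `H_{-α, -k}` and `H_{α, k}` coincide, so negative roots may be included freely.
-/
lemma mem_hyperplaneComplement_iff (b : P.Base) (x : V) :
    x ∈ hyperplaneComplement b ↔ ∀ i (k : ℤ), ⟪P.root i, x⟫ ≠ k := by
  refine ⟨fun h i k => ?_, fun h i _ k => h i k⟩
  by_cases hi : b.IsPos i
  · exact h i hi k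
  · have h1 := h _ ((isPos_reflectionPerm_self b i).mpr hi) (-k)
    intro h2
    apply h1
    rw [hyperplane, mem_ofPred_eq, root_reflectionPerm_self, inner_neg_left, h2, Int.cast_neg]

/-- The points of the complement of the affine Weyl arrangement which are on the same side of each
hyperplane as `x`. -/
def cell (b : P.Base) (x : V) : Set V :=
  {y | y ∈ hyperplaneComplement b ∧
    ∀ (i : ι) (k : ℤ), (k : ℝ) < ⟪P.root i, x⟫ ↔ (k : ℝ) < ⟪P.root i, y⟫}

lemma mem_cell_self (b : P.Base) {x : V} (hx : x ∈ hyperplaneComplement b) : x ∈ cell b x :=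
  ⟨hx, fun _ _ => Iff.rfl⟩

lemma cell_eq_of_mem (b : P.Base) {x y : V} (h : y ∈ cell b x) : cell b y = cell b x := by
  ext z
  exact and_congr_right fun _ => forall₂_congr fun i k => by rw [h.2 i k]

lemma convex_cell (b : P.Base) (x : V) : Convex ℝ (cell b x) := by
  have h : cell b x = ⋂ (i : ι) (k : ℤ), if (k : ℝ) < ⟪P.root i, x⟫
      then {y | (k : ℝ) < ⟪P.root i, y⟫} else {y | ⟪P.root i, y⟫ < (k : ℝ)} := by
    ext y
    rw [cell, mem_ofPred_eq, mem_hyperplaneComplement_iff, mem_iInter₂]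
    simp only [← forall_and]
    refine forall₂_congr fun i k => ?_
    split_ifs with h
    · simp only [h, true_iff, mem_ofPred_eq]
      exact ⟨fun h => h.2, fun h => ⟨h.ne', h⟩⟩
    · simp only [h, false_iff, mem_ofPred_eq, not_lt]
      exact ⟨fun h => lt_of_le_of_ne h.2 h.1, fun h => ⟨h.ne, h.le⟩⟩
  have hl : ∀ i, IsLinearMap ℝ fun y : V => ⟪P.root i, y⟫ := fun i =>
    (innerₗ V (P.root i)).isLinear
  rw [h]
  refine convex_iInter₂ fun i k => ?_
  split_ifs
  · exact convex_halfSpace_gt (hl i) _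
  · exact convex_halfSpace_lt (hl i) _

/-- A cell is convex, hence connected. Conversely each root maps a connected set to an interval;
missing all integers, it stays on one side of each. -/
lemma connectedComponentIn_eq_cell (b : P.Base) {x : V} (hx : x ∈ hyperplaneComplement b) :
    connectedComponentIn (hyperplaneComplement b) x = cell b x := by
  refine Subset.antisymm (fun y hy => ⟨connectedComponentIn_subset _ _ hy, fun i k => ?_⟩)
    ((convex_cell b x).isPreconnected.subset_connectedComponentIn (mem_cell_self b hx)
      fun y hy => hy.1)
  have hpre : OrdConnected ((fun y => ⟪P.root i, y⟫) ''
      connectedComponentIn (hyperplaneComplement b) x) :=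
    (isPreconnected_connectedComponentIn.image _ (by fun_prop)).ordConnected
  have hx' := mem_image_of_mem (fun y => ⟪P.root i, y⟫) (mem_connectedComponentIn hx)
  have hy' := mem_image_of_mem (fun y => ⟪P.root i, y⟫) hy
  have hne : (k : ℝ) ∉ (fun y => ⟪P.root i, y⟫) ''
      connectedComponentIn (hyperplaneComplement b) x := by
    rintro ⟨z, hz, hzk⟩
    exact (mem_hyperplaneComplement_iff b z).mp (connectedComponentIn_subset _ _ hz) i k hzk
  constructor <;> intro h <;> by_contra! h'
  · exact hne (hpre.out hy' hx' ⟨h', h.le⟩)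
  · exact hne (hpre.out hx' hy' ⟨h', h.le⟩)

lemma isAlcove_iff (b : P.Base) (A : Set V) :
    IsAlcove b A ↔ ∃ x ∈ hyperplaneComplement b, A = cell b x :=
  exists_congr fun x => and_congr_right fun hx => by rw [connectedComponentIn_eq_cell b hx]

section Lattices

lemma exists_int_inner_of_mem_coweightLattice (b : P.Base) {γ : V}
    (hγ : γ ∈ coweightLattice b) (i : ι) : ∃ n : ℤ, ⟪P.root i, γ⟫ = n := by
  have h : ∀ v ∈ AddSubmonoid.closure (P.root '' (b.support : Set ι)), ∃ n : ℤ, ⟪v, γ⟫ = n := by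
    intro v hv
    induction hv using AddSubmonoid.closure_induction with
    | mem v hv =>
      obtain ⟨j, hj, rfl⟩ := hv
      exact hγ j hj
    | zero => exact ⟨0, by simp⟩
    | add u v _ _ hu hv =>
      obtain ⟨m, hm⟩ := hu
      obtain ⟨n, hn⟩ := hv
      exact ⟨m + n, by rw [inner_add_left, hm, hn, Int.cast_add]⟩
  rcases b.root_mem_or_neg_mem i with hi | hi
  · exact h _ hi
  · obtain ⟨n, hn⟩ := h _ hi
    exact ⟨-n, by rw [Int.cast_neg, ← hn, inner_neg_left, neg_neg]⟩

lemma corootLattice_le_coweightLattice [P.IsCrystallographic] (hP : IsEuclidean P) (b : P.Base) :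
    corootLattice P ≤ coweightLattice b := by
  rw [corootLattice, AddSubgroup.closure_le]
  rintro _ ⟨j, rfl⟩ i _
  refine ⟨P.pairingIn ℤ i j, ?_⟩
  rw [← hP.toLinearMap_apply, P.root_coroot_eq_pairing, ← P.algebraMap_pairingIn ℤ]
  rfl

lemma smul_mem_coweightLattice (hP : IsEuclidean P) (b : P.Base) (w : P.weylGroup) {γ : V}
    (hγ : γ ∈ coweightLattice b) : w • γ ∈ coweightLattice b := fun i _ => by
  rw [hP.inner_root_smul]
  exact exists_int_inner_of_mem_coweightLattice b hγ _

lemma smul_mem_corootLattice (hP : IsEuclidean P) (w : P.weylGroup) {γ : V}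
    (hγ : γ ∈ corootLattice P) : w • γ ∈ corootLattice P := by
  induction hγ using AddSubgroup.closure_induction with
  | mem v hv =>
    obtain ⟨j, rfl⟩ := hv
    rw [hP.smul_coroot]
    exact AddSubgroup.subset_closure ⟨_, rfl⟩
  | zero => rw [smul_zero]; exact zero_mem _
  | add u v _ _ hu hv => rw [smul_add]; exact add_mem hu hv
  | neg u _ hu => rw [smul_neg]; exact neg_mem hu

lemma coroot_mem_corootLattice (i : ι) : P.coroot i ∈ corootLattice P :=
  AddSubgroup.subset_closure ⟨i, rfl⟩

/-- A coweight is integral on every root, so the affine map permutes the hyperplanes: `H_{α, k}`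
pulls back to `H_{w⁻¹α, k - (α, γ)}`. -/
lemma mem_cell_smul_add (hP : IsEuclidean P) (b : P.Base) (w : P.weylGroup) {γ : V}
    (hγ : γ ∈ coweightLattice b) {x y : V} (hy : y ∈ cell b x) :
    w • y + γ ∈ cell b (w • x + γ) := by
  refine ⟨(mem_hyperplaneComplement_iff b _).mpr fun i k => ?_, fun i k => ?_⟩ <;>
    obtain ⟨n, hn⟩ := exists_int_inner_of_mem_coweightLattice b hγ i <;>
    simp only [inner_add_right, hn, hP.inner_root_smul]
  · have := (mem_hyperplaneComplement_iff b y).mp hy.1 (P.weylGroupToPerm w⁻¹ i) (k - n)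
    rw [Int.cast_sub] at this
    intro h
    exact this (by linarith)
  · have := hy.2 (P.weylGroupToPerm w⁻¹ i) (k - n)
    rw [Int.cast_sub, sub_lt_iff_lt_add, sub_lt_iff_lt_add] at this
    exact this

lemma image_cell (hP : IsEuclidean P) (b : P.Base) (w : P.weylGroup) {γ : V}
    (hγ : γ ∈ coweightLattice b) (x : V) :
    (fun y => w • y + γ) '' cell b x = cell b (w • x + γ) := by
  refine Subset.antisymm ?_ fun z hz => ⟨w⁻¹ • (z - γ), ?_, by simp⟩
  · rintro _ ⟨y, hy, rfl⟩
    exact mem_cell_smul_add hP b w hγ hy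
  · have h := mem_cell_smul_add hP b w⁻¹ (neg_mem (smul_mem_coweightLattice hP b w⁻¹ hγ)) hz
    rwa [smul_add, inv_smul_smul, add_neg_cancel_right, ← sub_eq_add_neg, ← smul_sub] at h

lemma smul_add_mem_hyperplaneComplement (hP : IsEuclidean P) (b : P.Base) (w : P.weylGroup)
    {γ : V} (hγ : γ ∈ coweightLattice b) {x : V} (hx : x ∈ hyperplaneComplement b) :
    w • x + γ ∈ hyperplaneComplement b :=
  (mem_cell_smul_add hP b w hγ (mem_cell_self b hx)).1

variable [P.IsRootSystem]

lemma eq_zero_of_forall_inner_root_eq_zero (b : P.Base) {x : V}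
    (hx : ∀ i ∈ b.support, ⟪P.root i, x⟫ = 0) : x = 0 := by
  refine InnerProductSpace.ext_inner_left_basis b.toWeightBasis fun i => ?_
  rw [Base.toWeightBasis_apply, hx i i.2, inner_zero_right]

/-- The coordinates of a vector given by the inner products with the simple roots. -/
noncomputable def simpleCoords (b : P.Base) : V ≃ₗ[ℝ] (b.support → ℝ) :=
  have : FiniteDimensional ℝ V := b.toWeightBasis.finiteDimensional_of_finite
  LinearEquiv.ofInjectiveOfFinrankEq (LinearMap.pi fun i : b.support => innerₗ V (P.root i))
    (by
      refine (injective_iff_map_eq_zero _).mpr fun x hx => ?_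
      exact eq_zero_of_forall_inner_root_eq_zero b fun i hi => congrFun hx ⟨i, hi⟩)
    (by rw [Module.finrank_eq_card_basis b.toWeightBasis, Module.finrank_fintype_fun_eq_card])

@[simp]
lemma simpleCoords_apply (b : P.Base) (x : V) (i : b.support) :
    simpleCoords b x i = ⟪P.root i, x⟫ := rfl

@[simp]
lemma inner_root_simpleCoords_symm (b : P.Base) (c : b.support → ℝ) (i : b.support) :
    ⟪P.root i, (simpleCoords b).symm c⟫ = c i := by
  rw [← simpleCoords_apply, LinearEquiv.apply_symm_apply]

end Lattices

/-! ### The fundamental alcove is a cell. -/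

section FundamentalAlcove

variable [Finite ι] [P.IsRootSystem] [P.IsCrystallographic] [P.IsReduced] [P.IsIrreducible]

lemma inner_root_le_inner_highestRoot (b : P.Base) {x : V}
    (hx : ∀ i ∈ b.support, 0 < ⟪P.root i, x⟫) (i : ι) :
    ⟪P.root i, x⟫ ≤ ⟪P.root (highestRoot b), x⟫ := by
  rcases eq_zero_or_inner_pos_of_mem_closure b hx (isHighestRoot_highestRoot b i) with h | h
  · rw [sub_eq_zero.mp h]
  · rw [inner_sub_left] at h
    linarith

lemma inner_root_pos_and_lt_one (b : P.Base) {x : V}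
    (hx : x ∈ fundamentalAlcove b) {i : ι} (hi : b.IsPos i) :
    0 < ⟪P.root i, x⟫ ∧ ⟪P.root i, x⟫ < 1 :=
  ⟨inner_root_pos_of_isPos b hx.1 hi, (inner_root_le_inner_highestRoot b hx.1 i).trans_lt hx.2⟩

open scoped Classical in
-- On `A°` positive roots take values in `(0, 1)` and negative ones in `(-1, 0)`, so the side of
-- each hyperplane does not depend on the point.
lemma int_lt_inner_root_iff (b : P.Base) {x : V} (hx : x ∈ fundamentalAlcove b) (i : ι) (k : ℤ) :
    (k : ℝ) < ⟪P.root i, x⟫ ↔ k < if b.IsPos i then 1 else 0 := by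
  split_ifs with hi
  · obtain ⟨h0, h1⟩ := inner_root_pos_and_lt_one b hx hi
    refine ⟨fun h => ?_, fun h => lt_of_le_of_lt ?_ h0⟩
    · exact_mod_cast h.trans h1
    · exact_mod_cast (by omega : k ≤ 0)
  · obtain ⟨h0, h1⟩ := inner_root_pos_and_lt_one b hx
      ((isPos_reflectionPerm_self b i).mpr hi)
    rw [root_reflectionPerm_self, inner_neg_left] at h0 h1
    refine ⟨fun h => ?_, fun h => lt_of_le_of_lt (b := -1) ?_ (by linarith)⟩
    · exact_mod_cast (by linarith : (k : ℝ) < 0)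
    · exact_mod_cast (by omega : k ≤ -1)

lemma fundamentalAlcove_subset_hyperplaneComplement (b : P.Base) :
    fundamentalAlcove b ⊆ hyperplaneComplement b := by
  intro x hx i hi k hk
  obtain ⟨h0, h1⟩ := inner_root_pos_and_lt_one b hx hi
  rw [show ⟪P.root i, x⟫ = k from hk] at h0 h1
  norm_cast at h0 h1
  omega

lemma cell_eq_fundamentalAlcove (b : P.Base) {a : V} (ha : a ∈ fundamentalAlcove b) :
    cell b a = fundamentalAlcove b := by
  classical
  ext y
  refine ⟨fun hy => ⟨fun i hi => ?_, ?_⟩, fun hy =>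
    ⟨fundamentalAlcove_subset_hyperplaneComplement b hy, fun i k => by
      rw [int_lt_inner_root_iff b ha, int_lt_inner_root_iff b hy]⟩⟩
  · exact_mod_cast (hy.2 i 0).mp (by exact_mod_cast ha.1 i hi)
  · refine lt_of_le_of_ne (not_lt.mp fun h => ?_)
      (by exact_mod_cast (mem_hyperplaneComplement_iff b y).mp hy.1 (highestRoot b) 1)
    have := (hy.2 (highestRoot b) 1).mpr (by exact_mod_cast h)
    rw [Int.cast_one] at this
    exact lt_asymm this ha.2

lemma fundamentalAlcove_nonempty (b : P.Base) : (fundamentalAlcove b).Nonempty := by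
  set S : ℝ := ∑ i, (mark b i : ℝ)
  have hS : 0 ≤ S := Finset.sum_nonneg fun i _ => by positivity
  -- With all simple coordinates equal to `1 / (1 + S)`, the highest root takes the value `S / (1 +
  -- S) < 1`.
  refine ⟨(simpleCoords b).symm fun _ => 1 / (1 + S), fun i hi => ?_, ?_⟩
  · rw [inner_root_simpleCoords_symm b _ ⟨i, hi⟩]
    positivity
  · simp only [highestRoot_eq_sum_mark, sum_inner, ← Nat.cast_smul_eq_nsmul ℝ, inner_smul_left,
      inner_root_simpleCoords_symm, ← Finset.sum_mul, conj_trivial]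
    change S * (1 / (1 + S)) < 1
    rw [mul_one_div, div_lt_one (by positivity)]
    linarith

lemma alcoveOf_eq_cell (hP : IsEuclidean P) (b : P.Base) (w : P.weylGroup) {γ : V}
    (hγ : γ ∈ coweightLattice b) {a : V} (ha : a ∈ fundamentalAlcove b) :
    alcoveOf b w γ = cell b (w • a + γ) := by
  rw [alcoveOf, ← cell_eq_fundamentalAlcove b ha, image_cell hP b w hγ]

lemma isAlcove_alcoveOf (hP : IsEuclidean P) (b : P.Base) (w : P.weylGroup) {γ : V}
    (hγ : γ ∈ coweightLattice b) : IsAlcove b (alcoveOf b w γ) := by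
  obtain ⟨a, ha⟩ := fundamentalAlcove_nonempty b
  exact (isAlcove_iff b _).mpr ⟨w • a + γ, smul_add_mem_hyperplaneComplement hP b w hγ
    (fundamentalAlcove_subset_hyperplaneComplement b ha), alcoveOf_eq_cell hP b w hγ ha⟩

end FundamentalAlcove

end Alcoves

/-! ### Transitivity of the affine Weyl group on alcoves. -/

section Transitivity

variable {ι V : Type*} [NormedAddCommGroup V] [InnerProductSpace ℝ V] {P : RootPairing ι ℝ V V}

/-- Reflecting `y` in a hyperplane `H_{α, k}` which separates `y` from `a` brings it closer to
`a`. -/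
lemma IsEuclidean.norm_reflect_sub_lt (hP : IsEuclidean P) (i : ι) (k : ℤ) {y a : V}
    (h : (⟪P.root i, y⟫ - k) * (⟪P.root i, a⟫ - k) < 0) :
    ‖weylGroup.ofIdx P i • y + k • P.coroot i - a‖ < ‖y - a‖ := by
  have h0 := root_inner_self_pos P i
  have h1 : weylGroup.ofIdx P i • y + k • P.coroot i - a =
      (y - a) - ((⟪P.root i, y⟫ - k) * (2 / ⟪P.root i, P.root i⟫)) • P.root i := by
    rw [hP.smul_ofIdx, ← Int.cast_smul_eq_zsmul ℝ, hP.coroot_eq]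
    module
  rw [h1, ← sq_lt_sq₀ (norm_nonneg _) (norm_nonneg _), norm_sub_sq_real, norm_smul, mul_pow,
    inner_smul_right, ← real_inner_self_eq_norm_sq (P.root i), real_inner_comm (P.root i) (y - a), inner_sub_right,
    Real.norm_eq_abs, sq_abs]
  -- This is the change in squared distance; its sign is that of the product of the two offsets from
  -- the hyperplane.
  have h2 : ((⟪P.root i, y⟫ - k) * (2 / ⟪P.root i, P.root i⟫)) ^ 2 * ⟪P.root i, P.root i⟫ -
      2 * ((⟪P.root i, y⟫ - k) * (2 / ⟪P.root i, P.root i⟫) * (⟪P.root i, y⟫ - ⟪P.root i, a⟫)) =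
      4 * ((⟪P.root i, y⟫ - k) * (⟪P.root i, a⟫ - k)) / ⟪P.root i, P.root i⟫ := by
    field_simp
    ring
  have h3 : 4 * ((⟪P.root i, y⟫ - k) * (⟪P.root i, a⟫ - k)) / ⟪P.root i, P.root i⟫ < 0 :=
    div_neg_of_neg_of_pos (by linarith) h0
  linarith

lemma IsEuclidean.norm_weylGroup_smul (hP : IsEuclidean P) (w : P.weylGroup) (x : V) :
    ‖w • x‖ = ‖x‖ := by
  rw [norm_eq_sqrt_real_inner, hP.inner_smul_smul, ← norm_eq_sqrt_real_inner]

/-- The simple coordinates are integers, bounded by Cauchy–Schwarz. -/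
lemma finite_coweightLattice_inter_norm_le [P.IsRootSystem] (b : P.Base) (R : ℝ) :
    {γ | γ ∈ coweightLattice b ∧ ‖γ‖ ≤ R}.Finite := by
  refine Set.Finite.of_finite_image (f := simpleCoords b) ?_ (simpleCoords b).injective.injOn
  refine (Set.Finite.pi' fun i : b.support => ((Set.finite_Icc (-⌈‖P.root i‖ * R⌉)
    ⌈‖P.root i‖ * R⌉).image (Int.cast : ℤ → ℝ))).subset ?_
  rintro _ ⟨γ, ⟨hγ, hR⟩, rfl⟩ i
  obtain ⟨n, hn⟩ := hγ i i.2
  refine ⟨n, ?_, by rw [simpleCoords_apply, hn]⟩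
  have h : |(n : ℝ)| ≤ ⌈‖P.root i‖ * R⌉ := by
    rw [← hn]
    exact (abs_real_inner_le_norm _ _).trans
      ((mul_le_mul_of_nonneg_left hR (norm_nonneg _)).trans (Int.le_ceil _))
  rw [abs_le] at h
  exact ⟨by exact_mod_cast h.1, by exact_mod_cast h.2⟩

variable [Finite ι] [P.IsRootSystem] [P.IsCrystallographic] [P.IsReduced] [P.IsIrreducible]

/-- Choose the image of `x` nearest to a point `a` of `A°`. A hyperplane separating it from `a`
would give a closer image by reflection, so it lies in `A°`. -/
lemma exists_mem_alcoveOf (hP : IsEuclidean P) (b : P.Base) {x : V}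
    (hx : x ∈ hyperplaneComplement b) :
    ∃ w : P.weylGroup, ∃ γ ∈ corootLattice P, x ∈ alcoveOf b w γ := by
  obtain ⟨a, ha⟩ := fundamentalAlcove_nonempty b
  -- Only images no farther from `a` than `x` compete; this makes the set finite, so that a minimum
  -- exists.
  let T : Set (P.weylGroup × V) :=
    {p | p.2 ∈ corootLattice P ∧ ‖p.1 • x + p.2 - a‖ ≤ ‖x - a‖}
  have hT : T.Finite := by
    refine ((Set.finite_univ (α := P.weylGroup)).prod
      (finite_coweightLattice_inter_norm_le b (‖x - a‖ + ‖a‖ + ‖x‖))).subset ?_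
    rintro ⟨w, γ⟩ ⟨hγ, hle⟩
    refine ⟨mem_univ _, corootLattice_le_coweightLattice hP b hγ, ?_⟩
    have h1 : γ = (w • x + γ - a) + a - w • x := by abel
    change ‖γ‖ ≤ _
    calc ‖γ‖ = ‖(w • x + γ - a) + a - w • x‖ := by rw [← h1]
      _ ≤ ‖w • x + γ - a‖ + ‖a‖ + ‖w • x‖ :=
        (norm_sub_le _ _).trans (by gcongr; exact norm_add_le _ _)
      _ ≤ _ := by rw [hP.norm_weylGroup_smul]; gcongr
  obtain ⟨⟨w, γ⟩, ⟨hγ, hle⟩, hmin⟩ := Set.exists_min_image T (fun p => ‖p.1 • x + p.2 - a‖) hT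
    ⟨(1, 0), zero_mem _, by simp⟩
  have hsep : ∀ i (k : ℤ), 0 ≤ (⟪P.root i, w • x + γ⟫ - k) * (⟪P.root i, a⟫ - k) := by
    intro i k
    by_contra! h
    have hlt := hP.norm_reflect_sub_lt i k h
    rw [smul_add, ← mul_smul, add_assoc] at hlt
    exact absurd hlt (not_lt.mpr (hmin (weylGroup.ofIdx P i * w,
      weylGroup.ofIdx P i • γ + k • P.coroot i) ⟨add_mem (smul_mem_corootLattice hP _ hγ)
        (zsmul_mem (coroot_mem_corootLattice i) k), hlt.le.trans hle⟩))
  have hy := (mem_hyperplaneComplement_iff b _).mp (smul_add_mem_hyperplaneComplement hP b w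
    (corootLattice_le_coweightLattice hP b hγ) hx)
  have hmem : w • x + γ ∈ fundamentalAlcove b := by
    refine ⟨fun i hi => lt_of_le_of_ne (not_lt.mp fun hlt => ?_)
      fun h => hy i 0 (by rw [← h, Int.cast_zero]), lt_of_le_of_ne (not_lt.mp fun hlt => ?_) ?_⟩
    · refine absurd (hsep i 0) (not_le.mpr ?_)
      simpa using mul_neg_of_neg_of_pos hlt (ha.1 i hi)
    · refine absurd (hsep (highestRoot b) 1) (not_le.mpr ?_)
      rw [Int.cast_one]
      exact mul_neg_of_pos_of_neg (sub_pos.mpr hlt) (sub_neg.mpr ha.2)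
    · exact_mod_cast hy (highestRoot b) 1
  refine ⟨w⁻¹, -(w⁻¹ • γ), neg_mem (smul_mem_corootLattice hP _ hγ), _, hmem, ?_⟩
  simp

lemma IsAlcove.exists_eq_alcoveOf (hP : IsEuclidean P) (b : P.Base) {A : Set V}
    (hA : IsAlcove b A) :
    ∃ w : P.weylGroup, ∃ γ ∈ corootLattice P, A = alcoveOf b w γ := by
  obtain ⟨x, hx, rfl⟩ := (isAlcove_iff b A).mp hA
  obtain ⟨w, γ, hγ, hmem⟩ := exists_mem_alcoveOf hP b hx
  obtain ⟨a, ha⟩ := fundamentalAlcove_nonempty b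
  refine ⟨w, γ, hγ, ?_⟩
  rw [alcoveOf_eq_cell hP b w (corootLattice_le_coweightLattice hP b hγ) ha] at hmem ⊢
  exact cell_eq_of_mem b hmem

end Transitivity

/-! ### Freeness of the affine Weyl group on alcoves. -/

section Freeness

variable {ι V : Type*} [NormedAddCommGroup V] [InnerProductSpace ℝ V] {P : RootPairing ι ℝ V V}

/-- No signs are needed, since the negative of a coroot is again a coroot. The length of the list
serves as an induction measure. -/
lemma exists_list_of_mem_corootLattice {γ : V} (hγ : γ ∈ corootLattice P) :
    ∃ L : List ι, γ = (L.map P.coroot).sum := by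
  induction hγ using AddSubgroup.closure_induction with
  | mem v hv =>
    obtain ⟨j, rfl⟩ := hv
    exact ⟨[j], by simp⟩
  | zero => exact ⟨[], by simp⟩
  | add u v _ _ hu hv =>
    obtain ⟨L, rfl⟩ := hu
    obtain ⟨M, rfl⟩ := hv
    exact ⟨L ++ M, by simp⟩
  | neg u _ hu =>
    obtain ⟨L, rfl⟩ := hu
    refine ⟨L.map fun i => P.reflectionPerm i i, ?_⟩
    rw [List.map_map, List.sum_neg, List.map_map]
    congr 1
    refine List.map_congr_left fun i _ => ?_
    simp [P.coroot_reflectionPerm]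

lemma exists_inner_coroot_pos (L : List ι) {x : V} (h : 0 < ⟪(L.map P.coroot).sum, x⟫) :
    ∃ j ∈ L, 0 < ⟪P.coroot j, x⟫ := by
  induction L with
  | nil => simp at h
  | cons a L ih =>
    by_cases ha : 0 < ⟪P.coroot a, x⟫
    · exact ⟨a, by simp, ha⟩
    · rw [List.map_cons, List.sum_cons, inner_add_left] at h
      obtain ⟨j, hj, hj'⟩ := ih (by linarith)
      exact ⟨j, List.mem_cons_of_mem _ hj, hj'⟩

/-- The coroot lattice contains no nonzero minuscule coweight. -/
lemma eq_zero_of_mem_corootLattice_of_abs_inner_le_one [P.IsCrystallographic]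
    (hP : IsEuclidean P) (b : P.Base) {γ : V} (hγ : γ ∈ corootLattice P)
    (h : ∀ i, |⟪P.root i, γ⟫| ≤ 1) : γ = 0 := by
  classical
  obtain ⟨L, rfl⟩ := exists_list_of_mem_corootLattice hγ
  induction hn : L.length using Nat.strong_induction_on generalizing L with
  | _ n ih =>
    by_contra hne
    -- Since `(γ, γ) > 0`, some coroot in the list pairs positively with `γ`, and by the bound `(αⱼ,
    -- γ) = 1`. Reflecting in `αⱼ` therefore just deletes that coroot from the list, while the bound
    -- on all roots persists.
    obtain ⟨j, hj, hpos⟩ := exists_inner_coroot_pos L (real_inner_self_pos.mpr hne)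
    obtain ⟨m, hm⟩ := exists_int_inner_of_mem_coweightLattice b
      (corootLattice_le_coweightLattice hP b hγ) j
    have hm0 : 0 < m := by
      rw [hP.coroot_eq, inner_smul_left, conj_trivial, hm] at hpos
      have := (pos_iff_pos_of_mul_pos hpos).mp (by have := root_inner_self_pos P j; positivity)
      exact_mod_cast this
    have hm1 : m ≤ 1 := by
      have := (le_abs_self _).trans (h j)
      rw [hm] at this
      exact_mod_cast this
    have hs : weylGroup.ofIdx P j • (L.map P.coroot).sum = ((L.erase j).map P.coroot).sum := by
      have h1 : (L.map P.coroot).sum = P.coroot j + ((L.erase j).map P.coroot).sum := by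
        rw [← List.sum_cons, ← List.map_cons]
        exact ((List.perm_cons_erase hj).map _).sum_eq
      rw [hP.smul_ofIdx, hm, (by omega : m = 1), Int.cast_one, one_smul, h1, add_sub_cancel_left]
    have h0 : ((L.erase j).map P.coroot).sum = 0 := by
      refine ih _ ?_ (L.erase j) ?_ (fun i => ?_) rfl
      · rw [List.length_erase_of_mem hj, ← hn]
        have := List.length_pos_of_mem hj
        omega
      · rw [← hs]
        exact smul_mem_corootLattice hP _ hγ
      · rw [← hs, hP.inner_root_smul]
        exact h _
    rw [h0, smul_eq_zero_iff_eq] at hs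
    exact hne hs

variable [Finite ι] [P.IsRootSystem] [P.IsCrystallographic] [P.IsReduced] [P.IsIrreducible]

/-- The affine Weyl group acts freely on the alcoves. -/
lemma eq_one_of_alcoveOf_eq_fundamentalAlcove (hP : IsEuclidean P) (b : P.Base)
    {u : P.weylGroup} {γ : V} (hγ : γ ∈ corootLattice P)
    (h : alcoveOf b u γ = fundamentalAlcove b) : u = 1 := by
  obtain ⟨a, ha⟩ := fundamentalAlcove_nonempty b
  have hua : u • a + γ ∈ fundamentalAlcove b := h ▸ mem_image_of_mem _ ha
  have habs : ∀ {x : V}, x ∈ fundamentalAlcove b → ∀ i,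
      -1 < ⟪P.root i, x⟫ ∧ ⟪P.root i, x⟫ < 1 := by
    intro x hx i
    by_cases hi : b.IsPos i
    · have := inner_root_pos_and_lt_one b hx hi
      constructor <;> linarith
    · have := inner_root_pos_and_lt_one b hx
        ((isPos_reflectionPerm_self b i).mpr hi)
      rw [root_reflectionPerm_self, inner_neg_left] at this
      constructor <;> linarith
  -- Both `a` and `u a + γ` lie in `A°`, where roots have absolute value below `1`; hence each
  -- integer `(α, γ)` lies strictly between `-2` and `2`.
  have h0 : γ = 0 := by
    refine eq_zero_of_mem_corootLattice_of_abs_inner_le_one hP b hγ fun i => ?_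
    obtain ⟨n, hn⟩ := exists_int_inner_of_mem_coweightLattice b
      (corootLattice_le_coweightLattice hP b hγ) i
    have h1 := habs ha (P.weylGroupToPerm u⁻¹ i)
    have h2 := habs hua i
    rw [inner_add_right, hP.inner_root_smul, hn] at h2
    have h3 : -2 < n := by exact_mod_cast (by linarith : (-2 : ℝ) < n)
    have h4 : n < 2 := by exact_mod_cast (by linarith : (n : ℝ) < 2)
    rw [hn, abs_le]
    exact ⟨by exact_mod_cast (by omega : -1 ≤ n), by exact_mod_cast (by omega : n ≤ 1)⟩
  refine hP.eq_one_of_forall_isPos b u fun i hi => ?_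
  by_contra hneg
  have h1 := (inner_root_pos_and_lt_one b hua
    ((isPos_reflectionPerm_self b _).mpr hneg)).1
  rw [h0, add_zero, root_reflectionPerm_self, inner_neg_left, ← P.weylGroup_apply_root,
    hP.inner_smul_smul] at h1
  linarith [ha.1 i hi]

lemma alcoveOf_mul (b : P.Base) (v w : P.weylGroup) (γ δ : V) :
    alcoveOf b (v * w) (v • γ + δ) = (fun x => v • x + δ) '' alcoveOf b w γ := by
  simp only [alcoveOf, image_image, smul_add, mul_smul, add_assoc]

lemma alcoveOf_one_zero (b : P.Base) : alcoveOf b 1 0 = fundamentalAlcove b := by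
  simp [alcoveOf]

/-- Reduces coincidences between alcoves to affine maps stabilizing `A°`. -/
lemma alcoveOf_inv_mul (b : P.Base) {w w' : P.weylGroup} {γ γ' : V}
    (h : alcoveOf b w γ = alcoveOf b w' γ') :
    alcoveOf b (w'⁻¹ * w) (w'⁻¹ • (γ - γ')) = fundamentalAlcove b := by
  rw [smul_sub, sub_eq_add_neg, alcoveOf_mul, h, ← alcoveOf_mul, inv_mul_cancel, add_neg_cancel,
    alcoveOf_one_zero]

lemma eq_of_alcoveOf_eq (hP : IsEuclidean P) (b : P.Base) {w w' : P.weylGroup} {γ γ' : V}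
    (hγ : γ - γ' ∈ corootLattice P) (h : alcoveOf b w γ = alcoveOf b w' γ') : w = w' :=
  (inv_mul_eq_one.mp (eq_one_of_alcoveOf_eq_fundamentalAlcove hP b
    (smul_mem_corootLattice hP _ hγ) (alcoveOf_inv_mul b h))).symm

end Freeness

section Reduced

variable {ι V : Type*} [NormedAddCommGroup V] [InnerProductSpace ℝ V] {P : RootPairing ι ℝ V V}

/-- Proportional roots of a reduced system are equal or opposite, and `0 ≤ r` excludes the latter.
-/
lemma eq_of_smul_root_eq [P.IsReduced] {i j : ι} {r : ℝ} (hr : 0 ≤ r)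
    (h : P.root i = r • P.root j) : i = j := by
  by_contra hne
  by_cases hneg : P.root i = -P.root j
  · have h1 : (r + 1) • P.root j = 0 := by rw [add_smul, ← h, hneg, one_smul, neg_add_cancel]
    rcases smul_eq_zero.mp h1 with h1 | h1
    · linarith
    · exact P.ne_zero j h1
  · have := IsReduced.linearIndependent P hne hneg
    rw [LinearIndependent.pair_iff] at this
    have := (this 1 (-r) (by rw [h]; module)).1
    exact one_ne_zero this

end Reduced

/-! ### Barycentric coordinates on the fundamental alcove and its affine symmetries. -/

section Barycentric

variable {ι V : Type*} [NormedAddCommGroup V] [InnerProductSpace ℝ V] {P : RootPairing ι ℝ V V}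
  [Finite ι] [P.IsRootSystem] [P.IsCrystallographic] [P.IsReduced] [P.IsIrreducible]

/-- A root above the highest root would exceed it at a point of `A°`, so the highest root is maximal
and has a positive expansion; linear independence identifies its coefficients with the marks. -/
lemma mark_pos (b : P.Base) (i : b.support) : 0 < mark b i := by
  obtain ⟨f, hf, hpos⟩ := exists_pos_of_maximal b (θ := highestRoot b) fun k hk => by
    obtain ⟨x, hx⟩ := fundamentalAlcove_nonempty b
    rcases eq_zero_or_inner_pos_of_mem_closure b hx.1 hk with h | h
    · exact P.root.injective (sub_eq_zero.mp h)
    · rw [inner_sub_left] at h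
      linarith [inner_root_le_inner_highestRoot b hx.1 k]
  have h := (highestRoot_eq_sum_mark b).symm.trans hf
  simp only [← Nat.cast_smul_eq_nsmul ℝ] at h
  have h1 := Fintype.linearIndependent_iffₛ.mp b.linearIndepOn_root.linearIndependent
    (fun i => (mark b i : ℝ)) (fun i => (f i : ℝ)) h i
  rw [show mark b i = f i by exact_mod_cast h1]
  exact hpos i

lemma extMark_pos (b : P.Base) (i : Option b.support) : 0 < extMark b i := by
  cases i with
  | none => exact one_pos
  | some i => exact mark_pos b i

lemma sum_extMark_smul_extRoot (b : P.Base) :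
    ∑ i, (extMark b i : ℝ) • extRoot b i = 0 := by
  simp only [Fintype.sum_option, extMark, extRoot, highestRoot_eq_sum_mark, Nat.cast_smul_eq_nsmul,
    one_smul, neg_add_cancel]

/-- The affine functions `x ↦ (αᵢ, x) + δ_{i,0}`, which are positive on the fundamental alcove and,
scaled by the marks, are its barycentric coordinates. -/
noncomputable def wallFun (b : P.Base) (i : Option b.support) (x : V) : ℝ :=
  ⟪extRoot b i, x⟫ + if i = none then 1 else 0

@[simp]
lemma wallFun_some (b : P.Base) (i : b.support) (x : V) :
    wallFun b (some i) x = ⟪P.root i, x⟫ := by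
  simp [wallFun, extRoot]

@[simp]
lemma wallFun_none (b : P.Base) (x : V) :
    wallFun b none x = 1 - ⟪P.root (highestRoot b), x⟫ := by
  simp [wallFun, extRoot, inner_neg_left, sub_eq_neg_add]

lemma mem_fundamentalAlcove_iff_wallFun_pos (b : P.Base) (x : V) :
    x ∈ fundamentalAlcove b ↔ ∀ i, 0 < wallFun b i x := by
  simp [fundamentalAlcove, Option.forall, and_comm]

lemma sum_extMark_mul_wallFun (b : P.Base) (x : V) :
    ∑ i, (extMark b i : ℝ) * wallFun b i x = 1 := by
  have h := congrArg (fun v => ⟪v, x⟫) (sum_extMark_smul_extRoot b)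
  simp only [sum_inner, inner_smul_left, inner_zero_left, conj_trivial] at h
  simp only [wallFun, mul_add, Finset.sum_add_distrib, h, zero_add, mul_ite, mul_one, mul_zero]
  simp [extMark]

lemma eq_of_forall_wallFun_eq (b : P.Base) {x y : V} (h : ∀ i, wallFun b i x = wallFun b i y) :
    x = y := by
  refine sub_eq_zero.mp (eq_zero_of_forall_inner_root_eq_zero b fun i hi => ?_)
  have := h (some ⟨i, hi⟩)
  rw [wallFun_some, wallFun_some] at this
  rw [inner_sub_right, this, sub_self]

/-- The simple coordinates can be prescribed freely, and the relation `∑ cᵢ · (wall function i) = 1`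
then fixes the remaining one, as `c₀ = 1`. -/
lemma exists_wallFun_eq (b : P.Base) (c : Option b.support → ℝ)
    (hc : ∑ i, (extMark b i : ℝ) * c i = 1) : ∃ x, ∀ i, wallFun b i x = c i := by
  have h : ∀ i : b.support, wallFun b (some i) ((simpleCoords b).symm fun i => c (some i)) =
      c (some i) := fun i => by simp
  refine ⟨(simpleCoords b).symm fun i => c (some i), fun i => ?_⟩
  cases i with
  | some i => exact h i
  | none =>
    have h1 := sum_extMark_mul_wallFun b ((simpleCoords b).symm fun i => c (some i))
    rw [← hc, Fintype.sum_option, Fintype.sum_option] at h1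
    simp only [h, add_left_inj, extMark, Nat.cast_one, one_mul] at h1
    exact h1

open scoped Classical in
lemma exists_vertex (b : P.Base) (i : Option b.support) :
    ∃ x, ∀ j, wallFun b j x = if j = i then (extMark b i : ℝ)⁻¹ else 0 := by
  refine exists_wallFun_eq b _ ?_
  have : (extMark b i : ℝ) ≠ 0 := by exact_mod_cast (extMark_pos b i).ne'
  simp [this]

/-- The vertices of the fundamental alcove. -/
noncomputable def vertex (b : P.Base) (i : Option b.support) : V :=
  (exists_vertex b i).choose

lemma wallFun_vertex_self (b : P.Base) (i : Option b.support) :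
    wallFun b i (vertex b i) = (extMark b i : ℝ)⁻¹ := by
  simp [vertex, (exists_vertex b i).choose_spec i]

lemma wallFun_vertex_of_ne (b : P.Base) {i j : Option b.support} (h : j ≠ i) :
    wallFun b j (vertex b i) = 0 := by
  simp [vertex, (exists_vertex b i).choose_spec j, h]

lemma sum_barycentric_smul_vertex (b : P.Base) (x : V) :
    ∑ i, ((extMark b i : ℝ) * wallFun b i x) • vertex b i = x := by
  classical
  refine eq_of_forall_wallFun_eq b fun j => ?_
  have h : ∀ i, (extMark b i : ℝ) * wallFun b i x * wallFun b j (vertex b i) =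
      if i = j then wallFun b j x else 0 := by
    intro i
    split_ifs with hij
    · subst hij
      have : (extMark b i : ℝ) ≠ 0 := by exact_mod_cast (extMark_pos b i).ne'
      rw [wallFun_vertex_self]
      field_simp
    · rw [wallFun_vertex_of_ne b (Ne.symm hij), mul_zero]
  have h1 : ∑ i, (extMark b i : ℝ) * wallFun b i x * wallFun b j (vertex b i) = wallFun b j x := by
    simp [h]
  rw [← h1]
  -- The constant term of the wall function passes through the sum because the weights add up to
  -- `1`.
  simp only [wallFun, mul_add (_ * _), Finset.sum_add_distrib, inner_sum, inner_smul_right]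
  congr 1
  rw [← Finset.sum_mul]
  have := sum_extMark_mul_wallFun b x
  simp only [wallFun] at this
  rw [this, one_mul]

/-- An affine function is determined by its values at the vertices of the fundamental alcove. -/
lemma inner_add_eq_sum_barycentric (b : P.Base) (v : V) (r : ℝ) (x : V) :
    ⟪v, x⟫ + r =
      ∑ i, (extMark b i : ℝ) * wallFun b i x * (⟪v, vertex b i⟫ + r) := by
  simp only [mul_add (_ * _), Finset.sum_add_distrib, ← Finset.sum_mul,
    sum_extMark_mul_wallFun, one_mul, ← inner_smul_right, ← inner_sum]
  rw [sum_barycentric_smul_vertex]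

/-- The half-open segment from an interior point to a vertex stays in `A°`, so a function positive
on `A°` cannot change sign along it. -/
lemma inner_vertex_add_nonneg (b : P.Base) {v : V} {r : ℝ}
    (h : ∀ x ∈ fundamentalAlcove b, 0 < ⟪v, x⟫ + r) (i : Option b.support) :
    0 ≤ ⟪v, vertex b i⟫ + r := by
  obtain ⟨a, ha⟩ := fundamentalAlcove_nonempty b
  by_contra! hneg
  have hapos := h a ha
  rw [mem_fundamentalAlcove_iff_wallFun_pos] at ha
  set p := ⟪v, a⟫ + r
  set q := ⟪v, vertex b i⟫ + r
  have hpq : 0 < p - q := by linarith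
  -- The parameter at which the affine function vanishes on the segment.
  set t := -q / (p - q) with ht
  have ht0 : 0 < t := div_pos (by linarith) hpq
  have ht1 : t ≤ 1 := (div_le_one hpq).mpr (by linarith)
  have hmem : t • a + (1 - t) • vertex b i ∈ fundamentalAlcove b := by
    rw [mem_fundamentalAlcove_iff_wallFun_pos]
    intro j
    have h1 : wallFun b j (t • a + (1 - t) • vertex b i) =
        t * wallFun b j a + (1 - t) * wallFun b j (vertex b i) := by
      simp only [wallFun, inner_add_right, inner_smul_right]
      ring
    have h2 : 0 ≤ wallFun b j (vertex b i) := by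
      by_cases hj : j = i
      · rw [hj, wallFun_vertex_self]; positivity
      · rw [wallFun_vertex_of_ne b hj]
    rw [h1]
    exact add_pos_of_pos_of_nonneg (mul_pos ht0 (ha j)) (mul_nonneg (by linarith) h2)
  have h3 := h _ hmem
  have h4 : ⟪v, t • a + (1 - t) • vertex b i⟫ + r = t * (p - q) + q := by
    simp only [inner_add_right, inner_smul_right, p, q]
    ring
  rw [h4, ht, div_mul_cancel₀ _ hpq.ne'] at h3
  linarith

/-- The indices of the extended simple roots. -/
noncomputable def extIndex (b : P.Base) : Option b.support → ι
  | none => P.reflectionPerm (highestRoot b) (highestRoot b)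
  | some i => i

lemma root_extIndex (b : P.Base) (i : Option b.support) : P.root (extIndex b i) = extRoot b i := by
  cases i with
  | none => exact root_reflectionPerm_self _
  | some i => rfl

/-- An affine map `x ↦ u x + δ` preserving the fundamental alcove permutes its walls. -/
lemma exists_wallFun_smul_add_eq (hP : IsEuclidean P) (b : P.Base) {u : P.weylGroup} {δ : V}
    (h : alcoveOf b u δ = fundamentalAlcove b) (i : Option b.support) :
    ∃ j, u • extRoot b i = extRoot b j ∧ ∀ x, wallFun b j (u • x + δ) = wallFun b i x := by
  have hg : ∀ x ∈ fundamentalAlcove b, u • x + δ ∈ fundamentalAlcove b :=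
    fun x hx => h ▸ mem_image_of_mem _ hx
  have hg' : ∀ x ∈ fundamentalAlcove b, u⁻¹ • (x - δ) ∈ fundamentalAlcove b := by
    intro x hx
    rw [← h] at hx
    obtain ⟨y, hy, rfl⟩ := hx
    simpa using hy
  -- `M j` is the `j`-th wall function composed with the affine map, and `N` below is the `i`-th
  -- composed with its inverse. Both are positive on `A°`, hence nonnegative at the vertices.
  set M : Option b.support → V → ℝ := fun j x =>
    ⟪u⁻¹ • extRoot b j, x⟫ + (⟪extRoot b j, δ⟫ + if j = none then 1 else 0) with hM
  have hMx : ∀ j x, wallFun b j (u • x + δ) = M j x := fun j x => by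
    simp only [hM, wallFun, inner_add_right, hP.inner_smul_left_eq, inv_inv, add_assoc]
  set N : V → ℝ := fun x =>
    ⟪u • extRoot b i, x⟫ + (-⟪u • extRoot b i, δ⟫ + if i = none then 1 else 0) with hN
  have hNx : ∀ x, wallFun b i (u⁻¹ • (x - δ)) = N x := fun x => by
    simp only [hN, wallFun, ← hP.inner_smul_left_eq, inner_sub_right]
    ring
  have hM0 : ∀ j k, 0 ≤ M j (vertex b k) := fun j k =>
    inner_vertex_add_nonneg b (fun x hx => (hMx j x).symm.trans_gt
      ((mem_fundamentalAlcove_iff_wallFun_pos b _).mp (hg x hx) j)) k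
  have hN0 : ∀ k, 0 ≤ N (vertex b k) := fun k =>
    inner_vertex_add_nonneg b (fun x hx => (hNx x).symm.trans_gt
      ((mem_fundamentalAlcove_iff_wallFun_pos b _).mp (hg' x hx) i)) k
  -- Evaluate `N` at the image of the `k`-th vertex, in barycentric coordinates. All terms are
  -- nonnegative, so for `k ≠ i` each is zero; an index `j` with `N (vertex b j) ≠ 0` then makes `M
  -- j` vanish at every vertex but the `i`-th, hence proportional to wall function `i`.
  have hexp : ∀ k, wallFun b i (vertex b k) =
      ∑ j, (extMark b j : ℝ) * M j (vertex b k) * N (vertex b j) := by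
    intro k
    have h1 := inner_add_eq_sum_barycentric b (u • extRoot b i)
      (-⟪u • extRoot b i, δ⟫ + if i = none then 1 else 0) (u • vertex b k + δ)
    simp only [hMx] at h1
    rw [← h1]
    change _ = N _
    rw [← hNx, add_sub_cancel_right, inv_smul_smul]
  have hmark : ∀ k, (0 : ℝ) < extMark b k := fun k => by exact_mod_cast extMark_pos b k
  obtain ⟨j, hj⟩ : ∃ j, N (vertex b j) ≠ 0 := by
    by_contra! hall
    have h1 := hexp i
    simp only [hall, mul_zero, Finset.sum_const_zero, wallFun_vertex_self] at h1
    exact (inv_pos.mpr (hmark i)).ne' h1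
  have hMj : ∀ k, k ≠ i → M j (vertex b k) = 0 := by
    intro k hk
    have h1 := hexp k
    rw [wallFun_vertex_of_ne b hk.symm, eq_comm, Finset.sum_eq_zero_iff_of_nonneg
      fun j _ => mul_nonneg (mul_nonneg (hmark j).le (hM0 j k)) (hN0 j)] at h1
    have h2 := h1 j (Finset.mem_univ j)
    simpa [hj, (hmark j).ne'] using h2
  set r : ℝ := extMark b i * M j (vertex b i) with hr
  have hr0 : 0 ≤ r := mul_nonneg (hmark i).le (hM0 j i)
  have hlin : ∀ x, M j x = r * wallFun b i x := by
    intro x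
    have h1 : M j x = ∑ k, (extMark b k : ℝ) * wallFun b k x * M j (vertex b k) :=
      inner_add_eq_sum_barycentric b _ _ x
    rw [h1, Finset.sum_eq_single i (fun k _ hk => by rw [hMj k hk, mul_zero])
      (fun hi => absurd (Finset.mem_univ i) hi), hr]
    ring
  -- Subtracting the values at `0` compares the linear parts; both are roots, so the factor `r ≥ 0`
  -- must be `1`.
  have hroot : u⁻¹ • extRoot b j = r • extRoot b i := by
    refine ext_inner_right ℝ fun x => ?_
    have h1 := hlin x
    have h2 := hlin 0
    simp only [hM, wallFun, inner_zero_right] at h1 h2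
    rw [inner_smul_left, conj_trivial]
    linarith
  have hidx : P.weylGroupToPerm u⁻¹ (extIndex b j) = extIndex b i := by
    refine eq_of_smul_root_eq (P := P) hr0 ?_
    rw [← P.weylGroup_apply_root, root_extIndex, root_extIndex, hroot]
  have hij : u⁻¹ • extRoot b j = extRoot b i := by
    rw [← root_extIndex, ← root_extIndex, P.weylGroup_apply_root, hidx]
  have hr1 : r = 1 := by
    rw [hij, ← root_extIndex] at hroot
    have h1 : (1 - r) • P.root (extIndex b i) = 0 := by
      rw [sub_smul, ← hroot, one_smul, sub_self]
    have := (smul_eq_zero.mp h1).resolve_right (P.ne_zero _)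
    linarith
  refine ⟨j, by rw [← hij, smul_inv_smul], fun x => ?_⟩
  rw [hMx, hlin, hr1, one_mul]

/-- An affine map `x ↦ u x + δ` preserving the fundamental alcove permutes the extended simple
roots, and the permutation preserves the marks. -/
lemma exists_perm_smul_extRoot_eq (hP : IsEuclidean P) (b : P.Base) {u : P.weylGroup} {δ : V}
    (h : alcoveOf b u δ = fundamentalAlcove b) :
    ∃ τ : Equiv.Perm (Option b.support), ∀ i,
      u • extRoot b i = extRoot b (τ i) ∧ extMark b (τ i) = extMark b i := by
  choose τ hτ hwall using exists_wallFun_smul_add_eq hP b h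
  have hmark : ∀ k, (0 : ℝ) < extMark b k := fun k => by exact_mod_cast extMark_pos b k
  have hinj : Function.Injective τ := by
    intro i k hik
    by_contra hne
    have h1 := (hwall i (vertex b i)).symm.trans (hik ▸ hwall k (vertex b i))
    rw [wallFun_vertex_self, wallFun_vertex_of_ne b (Ne.symm hne)] at h1
    exact (inv_pos.mpr (hmark i)).ne' h1
  let σ := Equiv.ofBijective τ (Finite.injective_iff_bijective.mp hinj)
  refine ⟨σ, fun i => ⟨hτ i, ?_⟩⟩
  -- At the image of the `i`-th vertex only the term of `τ i` survives, and the relation becomes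
  -- `c_{τ i} / cᵢ = 1`.
  have h1 := sum_extMark_mul_wallFun b (u • vertex b i + δ)
  rw [← Equiv.sum_comp σ] at h1
  simp only [σ, Equiv.ofBijective_apply, hwall] at h1 ⊢
  rw [Finset.sum_eq_single i (fun k _ hk => by rw [wallFun_vertex_of_ne b hk, mul_zero])
    (fun hi => absurd (Finset.mem_univ i) hi), wallFun_vertex_self,
    mul_inv_eq_one₀ (hmark i).ne'] at h1
  exact_mod_cast h1

/-- The roots `w αᵢ` and `w' αᵢ` differ by a mark-preserving permutation of indices. The
translations may be arbitrary vectors. -/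
lemma asc_eq_of_alcoveOf_eq (hP : IsEuclidean P) (b : P.Base) {w w' : P.weylGroup} {γ γ' : V}
    (h : alcoveOf b w γ = alcoveOf b w' γ') : asc b w = asc b w' := by
  classical
  obtain ⟨τ, hτ⟩ := exists_perm_smul_extRoot_eq hP b (alcoveOf_inv_mul b h)
  rw [asc, asc, eq_comm, ← Equiv.sum_comp τ]
  refine Finset.sum_congr rfl fun i _ => ?_
  rw [(hτ i).2, ← (hτ i).1, ← mul_smul, mul_inv_cancel_left]

lemma ascAlcove_alcoveOf (hP : IsEuclidean P) (b : P.Base) {w : P.weylGroup} {γ : V}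
    (hA : IsAlcove b (alcoveOf b w γ)) : ascAlcove b (alcoveOf b w γ) = asc b w := by
  obtain ⟨w', γ', hγ', h⟩ := hA.exists_eq_alcoveOf hP b
  have hex : ∃ p : P.weylGroup × V, p.2 ∈ corootLattice P ∧
      alcoveOf b w γ = alcoveOf b p.1 p.2 := ⟨(w', γ'), hγ', h⟩
  rw [ascAlcove, dif_pos hex]
  exact (asc_eq_of_alcoveOf_eq hP b hex.choose_spec.2).symm

end Barycentric

/-! ### Alcoves in the parallelepiped and the size of the fibres. -/

section Counting

variable {ι V : Type*} [NormedAddCommGroup V] [InnerProductSpace ℝ V] {P : RootPairing ι ℝ V V}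
  [Finite ι] [P.IsRootSystem] [P.IsCrystallographic] [P.IsReduced] [P.IsIrreducible]

lemma exists_alcoveOf_subset_parallelepiped (hP : IsEuclidean P) (b : P.Base)
    (w : P.weylGroup) : ∃ γ ∈ coweightLattice b, alcoveOf b w γ ⊆ parallelepiped b := by
  obtain ⟨a, ha⟩ := fundamentalAlcove_nonempty b
  -- Subtracting floors leaves the fractional parts of the simple coordinates of `w a`. They are
  -- nonzero as the point avoids the hyperplanes, and the resulting bounds hold on the whole cell.
  set γ : V := (simpleCoords b).symm fun i => -(⌊⟪P.root i, w • a⟫⌋ : ℝ)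
  have hγi : ∀ i : b.support, ⟪P.root i, γ⟫ = -(⌊⟪P.root i, w • a⟫⌋ : ℝ) :=
    inner_root_simpleCoords_symm b _
  have hγ : γ ∈ coweightLattice b := fun i hi =>
    ⟨-⌊⟪P.root i, w • a⟫⌋, by rw [hγi ⟨i, hi⟩, Int.cast_neg]⟩
  refine ⟨γ, hγ, fun y hy i hi => ?_⟩
  rw [alcoveOf_eq_cell hP b w hγ ha] at hy
  have hne := (mem_hyperplaneComplement_iff b _).mp (smul_add_mem_hyperplaneComplement hP b w hγ
    (fundamentalAlcove_subset_hyperplaneComplement b ha)) i 0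
  have h0 := hy.2 i 0
  have h1 := hy.2 i 1
  rw [inner_add_right, hγi ⟨i, hi⟩, ← sub_eq_add_neg, Int.self_sub_floor] at h0 h1 hne
  simp only [Int.cast_zero, Int.cast_one] at h0 h1 hne
  exact ⟨h0.mp (lt_of_le_of_ne (Int.fract_nonneg _) hne.symm),
    not_lt.mp fun h => (h1.mpr h).not_gt (Int.fract_lt_one _)⟩

/-- Two numbers in `(0, 1]` that differ by an integer are equal; apply this to each simple
coordinate. -/
lemma translation_eq_of_alcoveOf_subset_parallelepiped (b : P.Base) {w : P.weylGroup}
    {γ γ' : V} (hγ : γ ∈ coweightLattice b) (hγ' : γ' ∈ coweightLattice b)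
    (h : alcoveOf b w γ ⊆ parallelepiped b) (h' : alcoveOf b w γ' ⊆ parallelepiped b) :
    γ = γ' := by
  obtain ⟨a, ha⟩ := fundamentalAlcove_nonempty b
  refine sub_eq_zero.mp (eq_zero_of_forall_inner_root_eq_zero b fun i hi => ?_)
  obtain ⟨m, hm⟩ := hγ i hi
  obtain ⟨n, hn⟩ := hγ' i hi
  have h1 := h (mem_image_of_mem _ ha) i hi
  have h2 := h' (mem_image_of_mem _ ha) i hi
  rw [inner_add_right, hm] at h1
  rw [inner_add_right, hn] at h2
  have h3 : m - n < 1 := by exact_mod_cast (by linarith : (m : ℝ) - n < 1)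
  have h4 : n - m < 1 := by exact_mod_cast (by linarith : (n : ℝ) - m < 1)
  rw [inner_sub_right, hm, hn, (by omega : m = n), sub_self]

/-- Makes the translation part a function of `w`: a coweight translation preserving `A°` moves each
simple coordinate within `(0, 1)` by an integer, hence not at all. -/
lemma translation_eq_of_alcoveOf_eq (hP : IsEuclidean P) (b : P.Base) {w : P.weylGroup} {γ γ' : V}
    (hγ : γ ∈ coweightLattice b) (hγ' : γ' ∈ coweightLattice b)
    (h : alcoveOf b w γ = alcoveOf b w γ') : γ = γ' := by
  obtain ⟨a, ha⟩ := fundamentalAlcove_nonempty b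
  have h1 := alcoveOf_inv_mul b h
  rw [inv_mul_cancel] at h1
  have ha' : (1 : P.weylGroup) • a + w⁻¹ • (γ - γ') ∈ fundamentalAlcove b :=
    h1 ▸ mem_image_of_mem _ ha
  rw [one_smul] at ha'
  have h0 : w⁻¹ • (γ - γ') = 0 := by
    refine eq_zero_of_forall_inner_root_eq_zero b fun i hi => ?_
    obtain ⟨n, hn⟩ := smul_mem_coweightLattice hP b w⁻¹ (sub_mem hγ hγ') i hi
    have h2 := inner_root_pos_and_lt_one b ha (Base.isPos_of_mem_support hi)
    have h3 := inner_root_pos_and_lt_one b ha' (Base.isPos_of_mem_support hi)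
    rw [inner_add_right, hn] at h3
    have h4 : -1 < n := by exact_mod_cast (by linarith : (-1 : ℝ) < n)
    have h5 : n < 1 := by exact_mod_cast (by linarith : (n : ℝ) < 1)
    rw [hn, (by omega : n = 0), Int.cast_zero]
  exact sub_eq_zero.mp ((smul_eq_zero_iff_eq _).mp h0)

/-- The number of `w` such that a given alcove is a translate of `w(A°)` by a coweight is the index
of connection. -/
lemma card_alcoveOf_eq (hP : IsEuclidean P) (b : P.Base) {A : Set V} (hA : IsAlcove b A) :
    Nat.card {w : P.weylGroup // ∃ γ ∈ coweightLattice b, A = alcoveOf b w γ} =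
      indexOfConnection b := by
  rw [indexOfConnection, AddSubgroup.relIndex, AddSubgroup.index]
  let F : {w : P.weylGroup // ∃ γ ∈ coweightLattice b, A = alcoveOf b w γ} →
      coweightLattice b ⧸ (corootLattice P).addSubgroupOf (coweightLattice b) :=
    fun w => QuotientAddGroup.mk ⟨w.2.choose, w.2.choose_spec.1⟩
  refine Nat.card_congr (Equiv.ofBijective F ⟨fun w w' h => ?_, fun q => ?_⟩)
  · rw [eq_comm, QuotientAddGroup.eq, AddSubgroup.mem_addSubgroupOf] at h
    refine Subtype.ext (eq_of_alcoveOf_eq hP b (γ := w.2.choose) (γ' := w'.2.choose) ?_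
      (w.2.choose_spec.2.symm.trans w'.2.choose_spec.2))
    simpa [sub_eq_neg_add] using h
  -- To reach the class of `δ`, write the alcove `A - δ` as `w(A°) + γ` with `γ` in the coroot
  -- lattice, by transitivity; then `A = w(A°) + (γ + δ)`.
  · obtain ⟨⟨δ, hδ⟩, rfl⟩ := QuotientAddGroup.mk_surjective q
    obtain ⟨v, ε, hε, rfl⟩ := hA.exists_eq_alcoveOf hP b
    obtain ⟨w, γ, hγ, h⟩ := (isAlcove_alcoveOf hP b v (sub_mem
      (corootLattice_le_coweightLattice hP b hε) hδ)).exists_eq_alcoveOf hP b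
    have hw : alcoveOf b v ε = alcoveOf b w (γ + δ) := by
      have h1 := alcoveOf_mul b 1 v (ε - δ) δ
      rw [h, ← alcoveOf_mul] at h1
      simpa using h1
    have hγ' := corootLattice_le_coweightLattice hP b hγ
    have hex : ∃ γ ∈ coweightLattice b, alcoveOf b v ε = alcoveOf b w γ :=
      ⟨γ + δ, add_mem hγ' hδ, hw⟩
    refine ⟨⟨w, hex⟩, ?_⟩
    have hinj : hex.choose = γ + δ := translation_eq_of_alcoveOf_eq hP b hex.choose_spec.1
      (add_mem hγ' hδ) (hex.choose_spec.2.symm.trans hw)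
    rw [QuotientAddGroup.eq, AddSubgroup.mem_addSubgroupOf]
    change -hex.choose + δ ∈ corootLattice P
    rw [hinj, neg_add_rev, neg_add_cancel_comm]
    exact neg_mem hγ

end Counting

end AffineWeyl

theorem theorem3p5 {ι V : Type*} [Finite ι] [NormedAddCommGroup V] [InnerProductSpace ℝ V]
    (P : RootPairing ι ℝ V V) [P.IsRootSystem] [P.IsCrystallographic] [P.IsReduced]
    [P.IsIrreducible] (hP : AffineWeyl.IsEuclidean P) (b : P.Base) :
    -- `asc` is defined on all alcoves and invariant under translations
    (∀ A : Set V, AffineWeyl.IsAlcove b A →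
      (∃ w : P.weylGroup, ∃ γ ∈ AffineWeyl.corootLattice P, A = AffineWeyl.alcoveOf b w γ) ∧
      ∀ (w : P.weylGroup) (γ : V), A = AffineWeyl.alcoveOf b w γ →
        AffineWeyl.ascAlcove b A = AffineWeyl.asc b w) ∧
    -- the alcoves in the fundamental parallelepiped are finite in number, and the sum over them
    -- is the generalized Eulerian polynomial
    {A : Set V | AffineWeyl.IsAlcove b A ∧ A ⊆ AffineWeyl.parallelepiped b}.Finite ∧
    AffineWeyl.eulerianPolynomial b =
      ∑ᶠ A ∈ {A : Set V | AffineWeyl.IsAlcove b A ∧ A ⊆ AffineWeyl.parallelepiped b},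
        (Polynomial.X : Polynomial ℚ) ^ AffineWeyl.ascAlcove b A := by
  classical
  open AffineWeyl in
  refine ⟨fun A hA => ⟨hA.exists_eq_alcoveOf hP b, fun w γ h => ?_⟩, ?_⟩
  · subst h
    exact ascAlcove_alcoveOf hP b hA
  choose g hg hsub using exists_alcoveOf_subset_parallelepiped hP b
  set S := {A : Set V | IsAlcove b A ∧ A ⊆ parallelepiped b} with hSdef
  have hgS : ∀ w, alcoveOf b w (g w) ∈ S := fun w => ⟨isAlcove_alcoveOf hP b w (hg w), hsub w⟩
  have hfib : ∀ A ∈ S, ∀ w, alcoveOf b w (g w) = A ↔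
      ∃ γ ∈ coweightLattice b, A = alcoveOf b w γ := by
    refine fun A hA w => ⟨fun h => ⟨g w, hg w, h.symm⟩, ?_⟩
    rintro ⟨γ, hγ, rfl⟩
    rw [translation_eq_of_alcoveOf_subset_parallelepiped b (hg w) hγ (hsub w) hA.2]
  have hS : S.Finite := by
    refine (Set.finite_range fun w => alcoveOf b w (g w)).subset fun A hA => ?_
    obtain ⟨w, γ, hγ, h⟩ := hA.1.exists_eq_alcoveOf hP b
    exact ⟨w, (hfib A hA w).mpr ⟨γ, corootLattice_le_coweightLattice hP b hγ, h⟩⟩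
  refine ⟨hS, ?_⟩
  let := Fintype.ofFinite P.weylGroup
  have hcard : ∀ A ∈ S, (Finset.univ.filter fun w => alcoveOf b w (g w) = A).card =
      indexOfConnection b := by
    intro A hA
    rw [← card_alcoveOf_eq hP b hA.1, Nat.subtype_card]
    intro w
    simp [hfib A hA w]
  -- The index is the size of a fibre containing `w = 1`; this excludes the value `0` that an
  -- infinite index would take.
  have hf : (indexOfConnection b : ℚ) ≠ 0 := by
    rw [Nat.cast_ne_zero, ← hcard _ (hgS 1)]
    exact Finset.card_ne_zero_of_mem (Finset.mem_filter.mpr ⟨Finset.mem_univ 1, rfl⟩)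
  rw [eulerianPolynomial, finsum_mem_eq_finite_toFinset_sum _ hS]
  -- Group the Weyl group by fibres: each has `f` elements and a single value of `asc`.
  have hsum : ∑ w : P.weylGroup, (X : ℚ[X]) ^ asc b w =
      ∑ A ∈ hS.toFinset, C (indexOfConnection b : ℚ) * X ^ ascAlcove b A := by
    rw [← Finset.sum_fiberwise_of_maps_to (s := Finset.univ) (t := hS.toFinset)
      (g := fun w => alcoveOf b w (g w)) fun w _ => hS.mem_toFinset.mpr (hgS w)]
    refine Finset.sum_congr rfl fun A hA => ?_
    rw [hS.mem_toFinset] at hA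
    rw [← hcard A hA, Finset.sum_congr rfl (g := fun _ => (X : ℚ[X]) ^ ascAlcove b A),
      Finset.sum_const, nsmul_eq_mul, map_natCast]
    intro w hw
    obtain rfl := (Finset.mem_filter.mp hw).2
    rw [ascAlcove_alcoveOf hP b hA.1]
  rw [hsum, ← Finset.mul_sum, ← mul_assoc, ← C_mul, one_div, inv_mul_cancel₀ hf, C_1, one_mul]
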